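/- Let $(\Omega,\mathbb{P})$ be a probability space and $\theta:\Omega\to\Omega$ an invertible, bi-measurable, measure-preserving ergodic map. Fix $d\ge 1$ and a finite set $\mathcal{A}$. Let $\mathbb{S}$ (resp. $\mathbb{S}^\circ$) be the set of positive semidefinite (resp. positive definite) complex $d\times d$ matrices of trace $1$. A linear map $\phi$ on $M_d(\mathbb{C})$ is called positivity improving if it maps every nonzero positive semidefinite matrix to a positive definite one, and irreducible if $(\mathrm{id}+\phi)^{d-1}$ is positivity improving. For every $\omega\in\Omega$ let $(\psi_{\omega,a})_{a\in\mathcal{A}}$ be completely positive linear maps on $M_d(\mathbb{C})$, measurable in $\omega$, such that $\varphi_\omega:=\sum_{a}\psi_{\omega,a}$ is trace preserving and irreducible, and let $f_\omega(a)\in\mathbb{R}$ be measurable in $\omega$ for each $a\in\mathcal{A}$. For $\alpha\in\mathbb{R}$ put $$\varphi_\omega^{(\alpha)}:=\sum_{a\in\mathcal{A}}e^{-\alpha f_\omega(a)}\,\psi_{\omega,a},\qquad \phi\cdot X:=\frac{\phi(X)}{\operatorname{tr}\phi(X)}.$$ Assume: (A2) there is $N_0\in\mathbb{N}$ such that $\mathbb{P}\{\omega:\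 \varphi_{\theta^{N_0-1}\omega}\circ\cdots\circ\varphi_{\theta\omega}\circ\varphi_\omega \text{ is positivity improving}\}>0$; (A3) with $F_\omega:=\max_{a\in\mathcal{A}}|f_\omega(a)|$, $e^{\alpha F}\in L^1(\Omega,\mathbb{P})$ for all $\alpha\in\mathbb{R}$. For $X,Y\in\mathbb{S}$ let $m(X,Y):=\sup\{\lambda\ge 0:\lambda X\le Y\}$ and $\mathrm{d}(X,Y):=\dfrac{1-m(X,Y)m(Y,X)}{1+m(X,Y)m(Y,X)}$ (the projective metric), and let $\|\cdot\|_1$ be the trace norm. Then the following hold. 1. For each fixed $\alpha\in\mathbb{R}$, any two $\mathbb{S}^\circ$-valued random variables $W$ satisfying $\varphi^{(\alpha)}_\omega\cdot W_{\theta^{-1}\omega}=W_\omega$ for $\mathbb{P}$-almost every $\omega$ are equal $\mathbb{P}$-almost surely. 2. There is a family of random matrices $(Z^{(\alpha)})_{\alpha\in\mathbb{R}}$ which is simultaneously equivariant: for $\mathbb{P}$-almost every $\omega$, with one exceptional null set for all $\alpha$, one has $Z^{(\alpha)}_\omega\in\mathbb{S}^\circ$ and $\varphi^{(\alpha)}_\omega\cdot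 Z^{(\alpha)}_{\theta^{-1}\omega}=Z^{(\alpha)}_\omega$ for all $\alpha\in\mathbb{R}$. 3. For every simultaneously equivariant family $(Z^{(\alpha)})_{\alpha\in\mathbb{R}}$ as in 2, for $\mathbb{P}$-almost every $\omega$ the map $\alpha\mapsto Z^{(\alpha)}_\omega$ is continuous on $\mathbb{R}$, both in trace norm and in the metric $\mathrm{d}$: for every $\alpha\in\mathbb{R}$, $\|Z^{(\beta)}_\omega-Z^{(\alpha)}_\omega\|_1\to 0$ and $\mathrm{d}(Z^{(\beta)}_\omega,Z^{(\alpha)}_\omega)\to 0$ as $\beta\to\alpha$. -/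

import Mathlib

open MeasureTheory Filter
open scoped Topology ComplexOrder

noncomputable section

namespace QMP

/-- `ℬ(ℂᵈ)`, the `d × d` complex matrices. -/
abbrev Mat (d : ℕ) : Type := Matrix (Fin d) (Fin d) ℂ

/-- Linear maps `ℬ(ℂᵈ) → ℬ(ℂᵈ)`; multiplication is composition. -/
abbrev SuperOp (d : ℕ) : Type := Module.End ℂ (Mat d)

/-- `𝕊`: positive semidefinite matrices of trace one (density matrices). -/
def states (d : ℕ) : Set (Mat d) := {X | X.PosSemidef ∧ X.trace = 1}

/-- `𝕊°`: positive definite matrices of trace one. -/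
def faithfulStates (d : ℕ) : Set (Mat d) := {X | X.PosDef ∧ X.trace = 1}

/-- A map is positive if it preserves the cone of positive semidefinite matrices. -/
def IsPositive {d : ℕ} (φ : SuperOp d) : Prop :=
  ∀ X : Mat d, X.PosSemidef → (φ X).PosSemidef

/-- `φ ⊗ id` on `ℬ(ℂᵈ ⊗ ℂᵐ)`: apply `φ` to each of the `m²` blocks (of size `d × d`)
`X_{kl} = (X_{(i,k),(j,l)})_{i,j}`. -/
def ampliation {d : ℕ} (φ : SuperOp d) (m : ℕ)
    (X : Matrix (Fin d × Fin m) (Fin d × Fin m) ℂ) :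
    Matrix (Fin d × Fin m) (Fin d × Fin m) ℂ :=
  Matrix.of fun p q => φ (Matrix.of fun i j => X (i, p.2) (j, q.2)) p.1 q.1

/-- Complete positivity. -/
def IsCompletelyPositive {d : ℕ} (φ : SuperOp d) : Prop :=
  IsPositive φ ∧
    ∀ (m : ℕ) (X : Matrix (Fin d × Fin m) (Fin d × Fin m) ℂ),
      X.PosSemidef → (ampliation φ m X).PosSemidef

/-- Completely positive and trace preserving: completely positive, and maps `𝕊` to itself. -/
def IsCPTP {d : ℕ} (φ : SuperOp d) : Prop :=
  IsCompletelyPositive φ ∧ ∀ X ∈ states d, φ X ∈ states d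

/-- Maps every nonzero positive semidefinite matrix to a positive definite matrix. -/
def IsPositivityImproving {d : ℕ} (φ : SuperOp d) : Prop :=
  ∀ X : Mat d, X.PosSemidef → X ≠ 0 → (φ X).PosDef

/-- `(id + φ)^(d-1)` is positivity improving. -/
def IsIrreducible {d : ℕ} (φ : SuperOp d) : Prop :=
  IsPositivityImproving ((1 + φ) ^ (d - 1))

/-- The average channel `φ = ∑ₐ ψₐ`. -/
def channel {d : ℕ} {A : Type*} [Fintype A] (ψ : A → SuperOp d) : SuperOp d := ∑ a, ψ a

/-- A finite family of completely positive maps whose sum is an irreducible CPTP map. -/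
structure IsIrreducibleInstrument {d : ℕ} {A : Type*} [Fintype A] (ψ : A → SuperOp d) :
    Prop where
  completelyPositive : ∀ a, IsCompletelyPositive (ψ a)
  cptp : IsCPTP (channel ψ)
  irreducible : IsIrreducible (channel ψ)

/-- The deformed map `φ^{(α)} = ∑ₐ e^{-α f(a)} ψₐ`. -/
def deformed {d : ℕ} {A : Type*} [Fintype A] (ψ : A → SuperOp d) (f : A → ℝ) (α : ℝ) :
    SuperOp d :=
  ∑ a, ((Real.exp (-α * f a) : ℝ) : ℂ) • ψ a

/-- `φ_{θ^{n-1}ω} ∘ ⋯ ∘ φ_{θω} ∘ φ_ω`. -/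
def composition {d : ℕ} {Ω : Type*} (θ : Ω → Ω) (φ : Ω → SuperOp d) : ℕ → Ω → SuperOp d
  | 0, _ => 1
  | n + 1, ω => φ (θ^[n] ω) * composition θ φ n ω

/-- `F = maxₐ |f(a)|`. -/
def maxAbs {A : Type*} (f : A → ℝ) : ℝ := ⨆ a, |f a|

/-- The projective action `φ · X = φ(X) / tr φ(X)`. -/
def projAct {d : ℕ} (φ : SuperOp d) (X : Mat d) : Mat d := (φ X).trace⁻¹ • φ X

/-- The trace norm `‖X‖₁ = tr |X|`: the sum of the singular values of `X`, that is, of the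
square roots of the eigenvalues of `X* X`. -/
def traceNorm {d : ℕ} (X : Mat d) : ℝ :=
  ∑ i, Real.sqrt ((Matrix.isHermitian_conjTranspose_mul_self X).eigenvalues i)

/-- `m(X, Y) = sup {c ≥ 0 : c X ≤ Y}`, with the positive semidefinite order. -/
def mCoeff {d : ℕ} (X Y : Mat d) : ℝ :=
  sSup {c : ℝ | 0 ≤ c ∧ (Y - (c : ℂ) • X).PosSemidef}

/-- The projective metric `d(X, Y) = (1 - m(X,Y) m(Y,X)) / (1 + m(X,Y) m(Y,X))`. -/
def projDist {d : ℕ} (X Y : Mat d) : ℝ :=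
  (1 - mCoeff X Y * mCoeff Y X) / (1 + mCoeff X Y * mCoeff Y X)

/-- Measurability of a matrix-valued map (entrywise). -/
def MeasurableMat {d : ℕ} {Ω : Type*} [MeasurableSpace Ω] (W : Ω → Mat d) : Prop :=
  ∀ i j, Measurable fun ω => W ω i j

/-- At the point `ω`, `W` takes a value in `𝕊°` and satisfies
`φ_ω · W_{θ⁻¹ω} = W_ω`. -/
def IsEquivariantAt {d : ℕ} {Ω : Type*} [MeasurableSpace Ω] (θ : Ω ≃ᵐ Ω)
    (φ : Ω → SuperOp d) (W : Ω → Mat d) (ω : Ω) : Prop :=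
  W ω ∈ faithfulStates d ∧ projAct (φ ω) (W (θ.symm ω)) = W ω

/-- An `𝕊°`-valued random variable `W` with `φ_ω · W_{θ⁻¹ω} = W_ω` almost surely. -/
def IsEquivariantState {d : ℕ} {Ω : Type*} [MeasurableSpace Ω] (P : Measure Ω) (θ : Ω ≃ᵐ Ω)
    (φ : Ω → SuperOp d) (W : Ω → Mat d) : Prop :=
  MeasurableMat W ∧ ∀ᵐ ω ∂P, IsEquivariantAt θ φ W ω

/-- A family of random variables `Z^{(α)}`, one for each real `α`, with one null set outside of
which `Z^{(α)}_ω ∈ 𝕊°` and `φ^{(α)}_ω · Z^{(α)}_{θ⁻¹ω} = Z^{(α)}_ω` for all `α` at once. -/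
def IsEquivariantFamily {d : ℕ} {Ω : Type*} [MeasurableSpace Ω] (P : Measure Ω) (θ : Ω ≃ᵐ Ω)
    (φ : ℝ → Ω → SuperOp d) (Z : ℝ → Ω → Mat d) : Prop :=
  (∀ α, MeasurableMat (Z α)) ∧ ∀ᵐ ω ∂P, ∀ α, IsEquivariantAt θ (φ α) (Z α) ω

end QMP

end

/-! The argument is a Birkhoff–Hopf contraction on the cone of positive semidefinite matrices, made
uniform in `α`. If `a X ≤ Y ≤ b X`, a positive map preserves these bounds, and a mixing map, one
with `tr X · Ψ Y ≥ η tr Y · Ψ X`, shrinks the relative gap `(b - a) / a` by the factor `1 - η`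
(`Close.map_mixing`). By compactness of the states, a positivity improving map that preserves them
is mixing for some `η > 0`.

By (A2), some set on which `N` undeformed steps mix with a fixed constant and the weights `f` along
them are bounded by a fixed `k` has positive measure. Ergodicity and recurrence send almost every
backward orbit into it infinitely often (`exists_ae_frequently_mixingSet`). There the deformed maps
lie between `e^{-Rk}` and `e^{Rk}` times the channels whenever `|α| ≤ R`, so one constant `η` serves
all such `α`, and the full-measure set of `ω` does not depend on `α`.

Hence normalized products over the past forget their initial state, uniformly for bounded `α`
(`exists_past_dist_le`). An equivariant `W` satisfies `W_ω = (past product) · W_{θ^{-n}ω}`, which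
forces uniqueness. The past products applied to the identity form a Cauchy sequence whose limit is
equivariant. On each bounded interval `α ↦ Z^{(α)}_ω` is a uniform limit of continuous functions,
hence continuous entrywise and then in both metrics. Irreducibility ensures that each channel
preserves positive definiteness. -/

namespace QMP

variable {d : ℕ}

/-! ### The positive semidefinite cone: trace, quadratic form, compactness -/

section Cone

/-- The real part of the trace. -/
def tr (X : Mat d) : ℝ := X.trace.re

lemma tr_sub (X Y : Mat d) : tr (X - Y) = tr X - tr Y := by simp [tr]

lemma tr_smul (c : ℝ) (X : Mat d) : tr (c • X) = c * tr X := by simp [tr]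

lemma trace_eq_tr {X : Mat d} (hX : X.PosSemidef) : X.trace = (tr X : ℂ) := by
  have := (Complex.le_def.1 hX.trace_nonneg).2
  apply Complex.ext <;> simp [tr]
  simpa using this.symm

lemma tr_nonneg {X : Mat d} (hX : X.PosSemidef) : 0 ≤ tr X :=
  (Complex.le_def.1 hX.trace_nonneg).1

lemma tr_pos {X : Mat d} (hX : X.PosSemidef) (h0 : X ≠ 0) : 0 < tr X := by
  refine lt_of_le_of_ne (tr_nonneg hX) fun h => h0 ?_
  rw [← hX.trace_eq_zero_iff, trace_eq_tr hX, ← h, Complex.ofReal_zero]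

lemma ne_zero_of_tr_pos {X : Mat d} (h : 0 < tr X) : X ≠ 0 := by
  rintro rfl
  simp [tr] at h

lemma psd_smul {c : ℝ} (hc : 0 ≤ c) {X : Mat d} (hX : X.PosSemidef) : (c • X).PosSemidef :=
  hX.smul hc

lemma posDef_smul {c : ℝ} (hc : 0 < c) {X : Mat d} (hX : X.PosDef) : (c • X).PosDef :=
  hX.smul hc

/-- The real quadratic form of a matrix. -/
def quad (X : Mat d) (v : Fin d → ℂ) : ℝ := (star v ⬝ᵥ (X.mulVec v)).re

lemma quad_add (X Y : Mat d) (v : Fin d → ℂ) : quad (X + Y) v = quad X v + quad Y v := by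
  simp [quad, Matrix.add_mulVec]

lemma quad_sub (X Y : Mat d) (v : Fin d → ℂ) : quad (X - Y) v = quad X v - quad Y v := by
  simp [quad, Matrix.sub_mulVec]

lemma quad_smul (c : ℝ) (X : Mat d) (v : Fin d → ℂ) : quad (c • X) v = c * quad X v := by
  simp [quad, Matrix.smul_mulVec]

lemma quad_one (v : Fin d → ℂ) : quad 1 v = ∑ i, ‖v i‖ ^ 2 := by
  simp [quad, dotProduct, ← Complex.normSq_eq_norm_sq, Complex.normSq_apply]

lemma quad_smul_right (c : ℝ) (X : Mat d) (v : Fin d → ℂ) :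
    quad X (c • v) = c ^ 2 * quad X v := by
  simp [quad, Matrix.mulVec_smul]
  ring

lemma continuous_quad : Continuous fun p : Mat d × (Fin d → ℂ) => quad p.1 p.2 := by
  unfold quad dotProduct Matrix.mulVec dotProduct
  fun_prop

lemma isHermitian_quad_im {X : Mat d} (hX : X.IsHermitian) (v : Fin d → ℂ) :
    (star v ⬝ᵥ (X.mulVec v)).im = 0 := by
  have := hX.im_star_dotProduct_mulVec_self v
  simpa using this

lemma psd_iff_quad {X : Mat d} :
    X.PosSemidef ↔ X.IsHermitian ∧ ∀ v, 0 ≤ quad X v := by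
  refine ⟨fun h => ⟨h.1, fun v => (Complex.le_def.1 (h.dotProduct_mulVec_nonneg v)).1⟩,
    fun h => .of_dotProduct_mulVec_nonneg h.1 fun v => Complex.le_def.2 ⟨h.2 v, ?_⟩⟩
  simpa using (isHermitian_quad_im h.1 v).symm

lemma posDef_iff_quad {X : Mat d} :
    X.PosDef ↔ X.IsHermitian ∧ ∀ v, v ≠ 0 → 0 < quad X v := by
  refine ⟨fun h => ⟨h.1, fun v hv => (Complex.lt_def.1 (h.dotProduct_mulVec_pos hv)).1⟩,
    fun h => .of_dotProduct_mulVec_pos h.1 fun v hv => Complex.lt_def.2 ⟨h.2 v hv, ?_⟩⟩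
  simpa using (isHermitian_quad_im h.1 v).symm

lemma isClosed_psd : IsClosed {X : Mat d | X.PosSemidef} := by
  simp only [psd_iff_quad, Set.ofPred_and, Set.ofPred_forall]
  refine IsClosed.inter (isClosed_eq (by fun_prop) continuous_id) (isClosed_iInter fun v => ?_)
  exact isClosed_le continuous_const
    (continuous_quad.comp (continuous_id.prodMk continuous_const))

/-- Factor `X = B* B`: an entry is an inner product of two columns of `B`, whose squared norms are
diagonal entries of `X`. This turns order bounds into entrywise bounds; `psd_add_smul_one` goes the
other way. -/
lemma norm_entry_le_tr {X : Mat d} (hX : X.PosSemidef) (i j : Fin d) : ‖X i j‖ ≤ tr X := by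
  obtain ⟨B, rfl⟩ : ∃ B : Mat d, X = B.conjTranspose * B := by
    open scoped MatrixOrder in
    obtain ⟨B, hB⟩ := CStarAlgebra.nonneg_iff_eq_star_mul_self.1 (Matrix.nonneg_iff_posSemidef.2 hX)
    exact ⟨B, hB⟩
  have htr : tr (B.conjTranspose * B) = ∑ i, ∑ k, ‖B k i‖ ^ 2 := by
    simp [tr, Matrix.trace, Matrix.mul_apply, ← Complex.normSq_eq_norm_sq, Complex.normSq_apply]
  have hcol : ∀ i, ∑ k, ‖B k i‖ ^ 2 ≤ tr (B.conjTranspose * B) := fun i => by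
    rw [htr]
    exact Finset.single_le_sum (f := fun i => ∑ k, ‖B k i‖ ^ 2)
      (fun i _ => Finset.sum_nonneg fun k _ => by positivity) (Finset.mem_univ i)
  calc ‖(B.conjTranspose * B) i j‖ ≤ ∑ k, ‖B k i‖ * ‖B k j‖ := by
        rw [Matrix.mul_apply]
        refine (norm_sum_le _ _).trans_eq (Finset.sum_congr rfl fun k _ => by simp)
    _ ≤ ∑ k, (‖B k i‖ ^ 2 + ‖B k j‖ ^ 2) / 2 := Finset.sum_le_sum fun k _ => by
        nlinarith [sq_nonneg (‖B k i‖ - ‖B k j‖)]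
    _ = (∑ k, ‖B k i‖ ^ 2 + ∑ k, ‖B k j‖ ^ 2) / 2 := by
        rw [← Finset.sum_div, Finset.sum_add_distrib]
    _ ≤ tr (B.conjTranspose * B) := by linarith [hcol i, hcol j]

lemma abs_quad_le {X : Mat d} {r : ℝ} (h : ∀ i j, ‖X i j‖ ≤ r) (hr : 0 ≤ r)
    (v : Fin d → ℂ) : |quad X v| ≤ d * r * quad 1 v := by
  calc |quad X v| ≤ ‖star v ⬝ᵥ (X.mulVec v)‖ := Complex.abs_re_le_norm _
    _ ≤ ∑ i, ∑ j, ‖v i‖ * (r * ‖v j‖) := by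
        simp only [dotProduct, Matrix.mulVec, Finset.mul_sum]
        refine (norm_sum_le _ _).trans (Finset.sum_le_sum fun i _ =>
          (norm_sum_le _ _).trans (Finset.sum_le_sum fun j _ => ?_))
        simp only [norm_mul, Pi.star_apply, norm_star]
        gcongr
        exact h i j
    _ = r * (∑ i, ‖v i‖) ^ 2 := by
        rw [sq, Finset.sum_mul_sum, Finset.mul_sum]
        refine Finset.sum_congr rfl fun i _ => ?_
        rw [Finset.mul_sum]
        exact Finset.sum_congr rfl fun j _ => by ring
    _ ≤ r * (d * quad 1 v) := by
        rw [quad_one]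
        gcongr
        simpa using sq_sum_le_card_mul_sum_sq (s := Finset.univ) (f := fun i => ‖v i‖)
    _ = d * r * quad 1 v := by ring

lemma psd_add_smul_one {X : Mat d} (hX : X.IsHermitian) {r : ℝ} (h : ∀ i j, ‖X i j‖ ≤ r)
    (hr : 0 ≤ r) : (X + (d * r) • (1 : Mat d)).PosSemidef := by
  refine psd_iff_quad.2 ⟨hX.add (psd_smul (by positivity) .one).1, fun v => ?_⟩
  rw [quad_add, quad_smul]
  linarith [neg_le_of_abs_le (abs_quad_le h hr v)]

lemma isCompact_sphere : IsCompact {v : Fin d → ℂ | quad 1 v = 1} := by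
  have hc : Continuous fun v : Fin d → ℂ => quad 1 v :=
    continuous_quad.comp (continuous_const.prodMk continuous_id)
  refine (isCompact_closedBall (0 : Fin d → ℂ) 1).of_isClosed_subset
    (isClosed_eq hc continuous_const) fun v hv => ?_
  rw [mem_closedBall_zero_iff, pi_norm_le_iff_of_nonneg zero_le_one]
  intro i
  have : ‖v i‖ ^ 2 ≤ 1 := by
    rw [← show quad 1 v = 1 from hv, quad_one]
    exact Finset.single_le_sum (f := fun i => ‖v i‖ ^ 2) (fun _ _ => by positivity)
      (Finset.mem_univ i)
  exact (sq_le_one_iff₀ (norm_nonneg _)).1 this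

lemma quad_one_pos {v : Fin d → ℂ} (hv : v ≠ 0) : 0 < quad 1 v :=
  (posDef_iff_quad.1 Matrix.PosDef.one).2 v hv

lemma quad_zero_right (X : Mat d) : quad X 0 = 0 := by simp [quad]

/-- A compact set of positive definite matrices is uniformly positive definite. -/
lemma exists_uniform_lower_bound {K : Set (Mat d)} (hK : IsCompact K)
    (hpos : ∀ X ∈ K, X.PosDef) : ∃ ε : ℝ, 0 < ε ∧ ∀ X ∈ K, (X - ε • (1 : Mat d)).PosSemidef := by
  obtain ⟨ε, hε, h⟩ : ∃ ε : ℝ, 0 < ε ∧ ∀ X ∈ K, ∀ v, quad 1 v = 1 → ε ≤ quad X v := by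
    rcases (K ×ˢ {v : Fin d → ℂ | quad 1 v = 1}).eq_empty_or_nonempty with he | hne
    · exact ⟨1, one_pos, fun X hX v hv =>
        (Set.eq_empty_iff_forall_notMem.1 he (X, v) ⟨hX, hv⟩).elim⟩
    · obtain ⟨p, hp, hmin⟩ := (hK.prod isCompact_sphere).exists_isMinOn hne
        continuous_quad.continuousOn
      refine ⟨quad p.1 p.2, (posDef_iff_quad.1 (hpos _ hp.1)).2 _ ?_, fun X hX v hv =>
        hmin (Set.mk_mem_prod hX hv)⟩
      intro h0
      have := hp.2
      simp [h0, quad_zero_right] at this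
  refine ⟨ε, hε, fun X hX => psd_iff_quad.2
    ⟨(hpos X hX).1.sub (psd_smul hε.le .one).1, fun v => ?_⟩⟩
  rcases eq_or_ne v 0 with rfl | hv
  · simp [quad_zero_right]
  have hq := quad_one_pos hv
  -- Both quadratic forms are homogeneous of degree two, so `v` may be rescaled to the unit sphere.
  have h1 := h X hX ((Real.sqrt (quad 1 v))⁻¹ • v) (by
    rw [quad_smul_right, inv_pow, Real.sq_sqrt hq.le, inv_mul_cancel₀ hq.ne'])
  rw [quad_smul_right, inv_pow, Real.sq_sqrt hq.le, inv_mul_eq_div, le_div_iff₀ hq] at h1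
  rw [quad_sub, quad_smul]
  linarith

lemma exists_lower_bound {X : Mat d} (hX : X.PosDef) :
    ∃ ε : ℝ, 0 < ε ∧ (X - ε • (1 : Mat d)).PosSemidef := by
  obtain ⟨ε, h, h'⟩ := exists_uniform_lower_bound (isCompact_singleton (x := X)) (by simpa using hX)
  exact ⟨ε, h, h' X rfl⟩

lemma posDef_of_lower_bound {X Y : Mat d} (hX : X.PosDef) {a : ℝ} (ha : 0 < a)
    (h : (Y - a • X).PosSemidef) : Y.PosDef := by
  rw [← sub_add_cancel Y (a • X)]
  exact Matrix.PosDef.posSemidef_add h (posDef_smul ha hX)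

lemma continuous_tr : Continuous (tr : Mat d → ℝ) := by
  unfold tr Matrix.trace
  fun_prop

lemma mem_states_iff {X : Mat d} : X ∈ states d ↔ X.PosSemidef ∧ tr X = 1 := by
  refine and_congr_right fun h => ?_
  rw [trace_eq_tr h]
  norm_cast

lemma isClosed_states : IsClosed (states d) := by
  have : states d = {X | X.PosSemidef} ∩ {X | tr X = 1} := by
    ext X; exact mem_states_iff
  rw [this]
  exact isClosed_psd.inter (isClosed_eq continuous_tr continuous_const)

lemma isCompact_states : IsCompact (states d) := by
  have hb : IsCompact {X : Mat d | ∀ i, X i ∈ {v : Fin d → ℂ | ∀ j, v j ∈ Metric.closedBall 0 1}} :=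
    isCompact_pi_infinite fun _ => isCompact_pi_infinite fun _ => isCompact_closedBall _ _
  refine hb.of_isClosed_subset isClosed_states fun X hX i j => ?_
  obtain ⟨h, h1⟩ := mem_states_iff.1 hX
  simpa [h1] using norm_entry_le_tr h i j

lemma normalize_mem_states {X : Mat d} (hX : X.PosSemidef) (h0 : X ≠ 0) :
    (tr X)⁻¹ • X ∈ states d := by
  have := tr_pos hX h0
  exact mem_states_iff.2 ⟨psd_smul (by positivity) hX, by rw [tr_smul, inv_mul_cancel₀ this.ne']⟩

end Cone

/-! ### Birkhoff–Hopf contraction by mixing maps -/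

section Contraction

/-- `a X ≤ Y ≤ b X` for some `0 < a` and `b ≤ (1 + δ) a`. -/
def Close (δ : ℝ) (X Y : Mat d) : Prop :=
  ∃ a b : ℝ, 0 < a ∧ b - a ≤ δ * a ∧ (Y - a • X).PosSemidef ∧ (b • X - Y).PosSemidef

/-- `tr(X) Ψ(Y) ≥ η tr(Y) Ψ(X)` on the cone of positive semidefinite matrices. -/
def IsMixing (η : ℝ) (Ψ : SuperOp d) : Prop :=
  ∀ X Y : Mat d, X.PosSemidef → Y.PosSemidef →
    (tr X • Ψ Y - (η * tr Y) • Ψ X).PosSemidef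

lemma map_real_smul (Ψ : SuperOp d) (c : ℝ) (X : Mat d) : Ψ (c • X) = c • Ψ X :=
  LinearMap.map_smul_of_tower Ψ c X

lemma Close.map {δ : ℝ} {X Y : Mat d} (h : Close δ X Y) {Ψ : SuperOp d} (hΨ : IsPositive Ψ) :
    Close δ (Ψ X) (Ψ Y) := by
  obtain ⟨a, b, ha, hab, h1, h2⟩ := h
  refine ⟨a, b, ha, hab, ?_, ?_⟩
  · simpa [map_real_smul] using hΨ _ h1
  · simpa [map_real_smul] using hΨ _ h2

/-- Mixing used once for `(X, Y)` and once for `(Y, X)` gives a lower and an upper constant with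
ratio `η⁻¹ ^ 2`, whatever the two inputs. -/
lemma IsMixing.close {η : ℝ} (hη : 0 < η) {Ψ : SuperOp d} (h : IsMixing η Ψ) {X Y : Mat d}
    (hX : X.PosSemidef) (hX0 : X ≠ 0) (hY : Y.PosSemidef) (hY0 : Y ≠ 0) :
    Close (η⁻¹ ^ 2) (Ψ X) (Ψ Y) := by
  have hx := tr_pos hX hX0
  have hy := tr_pos hY hY0
  refine ⟨η * tr Y / tr X, tr Y / (η * tr X), by positivity, ?_, ?_, ?_⟩
  · have : η⁻¹ ^ 2 * (η * tr Y / tr X) = tr Y / (η * tr X) := by field_simp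
    rw [this]
    linarith [show 0 < η * tr Y / tr X by positivity]
  · convert psd_smul (inv_nonneg.2 hx.le) (h X Y hX hY) using 1
    rw [smul_sub, smul_smul, smul_smul, inv_mul_cancel₀ hx.ne', one_smul, inv_mul_eq_div]
  · convert psd_smul (inv_nonneg.2 (mul_pos hη hx).le) (h Y X hY hX) using 1
    rw [smul_sub, smul_smul, smul_smul, inv_mul_cancel₀ (mul_pos hη hx).ne', one_smul,
      inv_mul_eq_div]

/-- Put `t = tr Y / tr X`. Mixing applied to `Y - a X` and `b X - Y` improves the bounds to `a + η
(t - a)` and `b - η (b - t)`. The gap becomes `(1 - η) (b - a)`, while the lower constant does not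
decrease because `a ≤ t`. -/
lemma Close.map_mixing {η δ : ℝ} (hη : 0 < η) (hη1 : η ≤ 1) (hδ : 0 ≤ δ) {Ψ : SuperOp d}
    (h : IsMixing η Ψ) {X Y : Mat d} (hX : X.PosSemidef) (hX0 : X ≠ 0) (hXY : Close δ X Y) :
    Close ((1 - η) * δ) (Ψ X) (Ψ Y) := by
  have hx := tr_pos hX hX0
  obtain ⟨a, b, ha, hab, h1, h2⟩ := hXY
  have ht := tr_nonneg h1
  rw [tr_sub, tr_smul] at ht
  have hr : a ≤ tr Y / tr X := by rw [le_div_iff₀ hx]; linarith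
  refine ⟨a + η * (tr Y / tr X - a), b - η * (b - tr Y / tr X), ?_, ?_, ?_, ?_⟩
  · nlinarith
  · have h3 : (1 - η) * (b - a) ≤ (1 - η) * (δ * a) :=
      mul_le_mul_of_nonneg_left hab (by linarith)
    have h4 : 0 ≤ (1 - η) * δ * (η * (tr Y / tr X - a)) :=
      mul_nonneg (mul_nonneg (by linarith) hδ) (mul_nonneg hη.le (by linarith))
    linarith
  · convert psd_smul (inv_nonneg.2 hx.le) (h X _ hX h1) using 1
    rw [tr_sub, tr_smul, map_sub, map_real_smul]
    match_scalars <;> (field_simp; try ring)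
  · convert psd_smul (inv_nonneg.2 hx.le) (h X _ hX h2) using 1
    rw [tr_sub, tr_smul, map_sub, map_real_smul]
    match_scalars <;> field_simp

lemma IsMixing.mono {η η' : ℝ} {Ψ : SuperOp d} (h : IsMixing η Ψ) (hΨ : IsPositive Ψ)
    (hle : η' ≤ η) : IsMixing η' Ψ := fun X Y hX hY => by
  convert (h X Y hX hY).add (psd_smul (mul_nonneg (sub_nonneg.2 hle) (tr_nonneg hY)) (hΨ X hX))
    using 1
  module

/-- In the cone order, `tr X · Ψ Y ≥ c tr X · Ψ₀ Y ≥ c η tr Y · Ψ₀ X ≥ (c η / C) tr Y · Ψ X`. -/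
lemma IsMixing.of_comparable {η c C : ℝ} (hη : 0 ≤ η) (hc : 0 ≤ c) (hC : 0 < C)
    {Ψ₀ Ψ : SuperOp d} (h : IsMixing η Ψ₀)
    (h1 : ∀ X : Mat d, X.PosSemidef → (Ψ X - c • Ψ₀ X).PosSemidef)
    (h2 : ∀ X : Mat d, X.PosSemidef → (C • Ψ₀ X - Ψ X).PosSemidef) :
    IsMixing (c * η / C) Ψ := fun X Y hX hY => by
  have hy := tr_nonneg hY
  convert ((psd_smul (tr_nonneg hX) (h1 Y hY)).add (psd_smul hc (h X Y hX hY))).add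
    (psd_smul (show 0 ≤ c * η / C * tr Y by positivity) (h2 X hX)) using 1
  match_scalars <;> field_simp <;> ring

/-- The image of the compact set of states is bounded below by some `ε • 1`, and above by `(d + 1) •
1` since states have entries of modulus at most one. The quotient of the bounds is the mixing
constant. -/
lemma IsPositivityImproving.exists_isMixing {Ψ : SuperOp d}
    (hst : ∀ X ∈ states d, Ψ X ∈ states d) (hΨ : IsPositivityImproving Ψ) :
    ∃ η : ℝ, 0 < η ∧ IsMixing η Ψ := by
  obtain ⟨ε, hε, h⟩ := exists_uniform_lower_bound
    (isCompact_states.image (Ψ.continuous_of_finiteDimensional)) (by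
      rintro _ ⟨X, hX, rfl⟩
      refine hΨ X hX.1 ?_
      rintro rfl
      simpa using hX.2)
  refine ⟨ε / (d + 1), by positivity, fun X Y hX hY => ?_⟩
  rcases eq_or_ne X 0 with rfl | hX0
  · simpa [tr] using Matrix.PosSemidef.zero
  rcases eq_or_ne Y 0 with rfl | hY0
  · simpa [tr] using Matrix.PosSemidef.zero
  have hx := tr_pos hX hX0
  have hy := tr_pos hY hY0
  have hY' := h _ ⟨_, normalize_mem_states hY hY0, rfl⟩
  have hX' := mem_states_iff.1 (hst _ (normalize_mem_states hX hX0))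
  -- The entry bound already gives `d`; the extra one keeps the denominator positive without
  -- assuming `d ≠ 0`.
  have hX'' : (((d : ℝ) + 1) • (1 : Mat d) - Ψ ((tr X)⁻¹ • X)).PosSemidef := by
    convert (psd_add_smul_one (X := -Ψ ((tr X)⁻¹ • X)) hX'.1.1.neg (r := 1)
      (fun i j => by
        simpa only [Matrix.neg_apply, norm_neg, hX'.2] using norm_entry_le_tr hX'.1 i j) zero_le_one).add
      Matrix.PosSemidef.one using 1
    module
  rw [map_real_smul] at hX'' hY'
  convert (psd_smul (mul_nonneg hx.le hy.le) hY').add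
    (psd_smul (show 0 ≤ ε / (d + 1) * tr Y * tr X by positivity) hX'') using 1
  match_scalars <;> (field_simp; try ring)

/-- Positive maps that preserve positive definiteness and annihilate no nonzero element of the
cone. -/
structure IsFaithfulMap (Ψ : SuperOp d) : Prop where
  pos : IsPositive Ψ
  posDef : ∀ X : Mat d, X.PosDef → (Ψ X).PosDef
  ne_zero : ∀ X : Mat d, X.PosSemidef → X ≠ 0 → Ψ X ≠ 0

lemma IsFaithfulMap.one : IsFaithfulMap (1 : SuperOp d) :=
  ⟨fun _ h => h, fun _ h => h, fun _ _ h => h⟩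

lemma IsFaithfulMap.mul {Φ Ψ : SuperOp d} (hΦ : IsFaithfulMap Φ) (hΨ : IsFaithfulMap Ψ) :
    IsFaithfulMap (Φ * Ψ) :=
  ⟨fun X h => hΦ.pos _ (hΨ.pos X h), fun X h => hΦ.posDef _ (hΨ.posDef X h),
    fun X h h0 => hΦ.ne_zero _ (hΨ.pos X h) (hΨ.ne_zero X h h0)⟩

lemma IsFaithfulMap.of_comparable {Ψ₀ Ψ : SuperOp d} (h : IsFaithfulMap Ψ₀) (hΨ : IsPositive Ψ)
    {c : ℝ} (hc : 0 < c) (hle : ∀ X : Mat d, X.PosSemidef → (Ψ X - c • Ψ₀ X).PosSemidef) :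
    IsFaithfulMap Ψ := by
  refine ⟨hΨ, fun X hX => posDef_of_lower_bound (h.posDef X hX) hc (hle X hX.posSemidef),
    fun X hX h0 => ne_zero_of_tr_pos ?_⟩
  have h1 := tr_nonneg (hle X hX)
  have h2 := tr_pos (h.pos X hX) (h.ne_zero X hX h0)
  rw [tr_sub, tr_smul] at h1
  nlinarith

lemma projAct_smul (φ : SuperOp d) {c : ℂ} (hc : c ≠ 0) (X : Mat d) :
    projAct φ (c • X) = projAct φ X := by
  simp only [projAct, map_smul, Matrix.trace_smul, smul_smul, smul_eq_mul]
  congr 1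
  field_simp

lemma IsFaithfulMap.tr_pos {Ψ : SuperOp d} (h : IsFaithfulMap Ψ) {X : Mat d} (hX : X.PosSemidef)
    (h0 : X ≠ 0) : 0 < tr (Ψ X) := QMP.tr_pos (h.pos X hX) (h.ne_zero X hX h0)

lemma IsFaithfulMap.trace_ne_zero {Ψ : SuperOp d} (h : IsFaithfulMap Ψ) {X : Mat d}
    (hX : X.PosSemidef) (h0 : X ≠ 0) : (Ψ X).trace ≠ 0 := by
  rw [trace_eq_tr (h.pos X hX)]
  exact_mod_cast (h.tr_pos hX h0).ne'

lemma projAct_mul {Φ Ψ : SuperOp d} (hΨ : IsFaithfulMap Ψ) {X : Mat d} (hX : X.PosSemidef)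
    (h0 : X ≠ 0) : projAct (Φ * Ψ) X = projAct Φ (projAct Ψ X) := by
  conv_rhs => rw [projAct.eq_1 Ψ, projAct_smul _ (inv_ne_zero (hΨ.trace_ne_zero hX h0))]
  rfl

lemma projAct_eq {Ψ : SuperOp d} (h : IsPositive Ψ) {X : Mat d} (hX : X.PosSemidef) :
    projAct Ψ X = (tr (Ψ X))⁻¹ • Ψ X := by
  rw [projAct, trace_eq_tr (h X hX), ← Complex.ofReal_inv, Complex.coe_smul]

lemma IsFaithfulMap.projAct_mem {Ψ : SuperOp d} (h : IsFaithfulMap Ψ) {X : Mat d}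
    (hX : X.PosSemidef) (h0 : X ≠ 0) : projAct Ψ X ∈ states d := by
  rw [projAct_eq h.pos hX]
  exact normalize_mem_states (h.pos X hX) (h.ne_zero X hX h0)

lemma ne_zero_of_mem_states {X : Mat d} (hX : X ∈ states d) : X ≠ 0 :=
  ne_zero_of_tr_pos (by rw [(mem_states_iff.1 hX).2]; exact one_pos)

/-- After normalization the upper constant is at most `1 + δ`, so `(1 + δ) X' - Y'` is in the cone
with trace `δ`, which bounds its entries. Removing `δ X'` costs another `δ`. -/
lemma Close.norm_sub_le {δ : ℝ} {X Y : Mat d} (h : Close δ X Y) (hX : X.PosSemidef) (hX0 : X ≠ 0)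
    (i j : Fin d) : ‖(tr X)⁻¹ • X i j - (tr Y)⁻¹ • Y i j‖ ≤ 2 * δ := by
  have hx := tr_pos hX hX0
  obtain ⟨a, b, ha, hab, h1, h2⟩ := h
  have t1 := tr_nonneg h1
  have t2 := tr_nonneg h2
  rw [tr_sub, tr_smul] at t1 t2
  have hy : 0 < tr Y := by nlinarith
  have hδ : 0 ≤ δ := by
    have : a ≤ b := le_of_mul_le_mul_right (by linarith : a * tr X ≤ b * tr X) hx
    by_contra hneg
    nlinarith
  set X' := (tr X)⁻¹ • X with hX'
  set Y' := (tr Y)⁻¹ • Y with hY'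
  have htX : tr X' = 1 := by rw [hX', tr_smul, inv_mul_cancel₀ hx.ne']
  have htY : tr Y' = 1 := by rw [hY', tr_smul, inv_mul_cancel₀ hy.ne']
  have hXp : X'.PosSemidef := psd_smul (by positivity) hX
  have hP : (δ • X' - (Y' - X')).PosSemidef := by
    have hb : 0 ≤ δ + 1 - b * tr X / tr Y := by
      rw [sub_nonneg, div_le_iff₀ hy]
      nlinarith
    convert (psd_smul (inv_nonneg.2 hy.le) h2).add (psd_smul hb hXp) using 1
    rw [hX', hY']
    match_scalars <;> (field_simp; try ring)
  have e1 := norm_entry_le_tr hP i j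
  have e2 := norm_entry_le_tr hXp i j
  rw [tr_sub, tr_sub, tr_smul, htX, htY] at e1
  rw [htX] at e2
  have : (tr X)⁻¹ • X i j - (tr Y)⁻¹ • Y i j = (δ • X' - (Y' - X')) i j - δ • X' i j := by
    simp [hX', hY']
  rw [this]
  refine (_root_.norm_sub_le _ _).trans ?_
  rw [norm_smul, Real.norm_of_nonneg hδ]
  nlinarith

end Contraction

/-! ### Deformed maps and their comparison with the channel -/

section Deformed

variable {A : Type*} [Fintype A]

lemma IsPositive.add {Φ Ψ : SuperOp d} (hΦ : IsPositive Φ) (hΨ : IsPositive Ψ) :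
    IsPositive (Φ + Ψ) := fun X hX => (hΦ X hX).add (hΨ X hX)

/-- Suppose the form of `φ X` vanishes at `v ≠ 0`. Every `W ≥ 0` lies below a multiple of the
positive definite `X`, so the form of `φ W` also vanishes at `v`. Powers of `1 + φ` then preserve
vanishing at `v`, and starting them from `φ X ≠ 0` contradicts irreducibility. -/
lemma IsPositive.posDef_of_irreducible {φ : SuperOp d} (hφ : IsPositive φ)
    (hne : ∀ X : Mat d, X.PosSemidef → X ≠ 0 → φ X ≠ 0) (hirr : IsIrreducible φ)
    {X : Mat d} (hX : X.PosDef) : (φ X).PosDef := by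
  have hφX := hφ X hX.posSemidef
  refine posDef_iff_quad.2 ⟨hφX.1, fun v hv => lt_of_le_of_ne ((psd_iff_quad.1 hφX).2 v)
    fun h0 => ?_⟩
  have hX0 : X ≠ 0 := by
    rintro rfl
    simpa [quad] using (posDef_iff_quad.1 hX).2 v hv
  have hker : ∀ W : Mat d, W.PosSemidef → quad (φ W) v = 0 := fun W hW => by
    obtain ⟨ε, hε, hεX⟩ := exists_lower_bound hX
    have hr := tr_nonneg hW
    have hWle : ((((d : ℝ) * tr W) / ε) • X - W).PosSemidef := by
      convert (psd_smul (show 0 ≤ (d : ℝ) * tr W / ε by positivity) hεX).add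
        (psd_add_smul_one (X := -W) hW.1.neg (r := tr W)
          (fun i j => by simpa only [Matrix.neg_apply, norm_neg] using norm_entry_le_tr hW i j)
          hr) using 1
      match_scalars <;> (field_simp; try ring)
    have h1 := (psd_iff_quad.1 (hφ _ hWle)).2 v
    rw [map_sub, map_real_smul, quad_sub, quad_smul, ← h0] at h1
    exact le_antisymm (by linarith) ((psd_iff_quad.1 (hφ W hW)).2 v)
  have hiter : ∀ (k : ℕ) (W : Mat d), W.PosSemidef → quad W v = 0 →
      quad (((1 + φ) ^ k) W) v = 0 := by
    intro k
    induction k with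
    | zero => exact fun W _ h => h
    | succ k ih =>
      intro W hW h
      rw [pow_succ]
      refine ih (W + φ W) (hW.add (hφ W hW)) ?_
      rw [quad_add, h, hker W hW, add_zero]
  have hpd := (posDef_iff_quad.1 (hirr _ hφX (hne X hX.posSemidef hX0))).2 v hv
  rw [hiter _ _ hφX h0.symm] at hpd
  exact lt_irrefl _ hpd

lemma ne_zero_of_preserves_states {φ : SuperOp d} (hst : ∀ X ∈ states d, φ X ∈ states d)
    {X : Mat d} (hX : X.PosSemidef) (h0 : X ≠ 0) : φ X ≠ 0 := by
  intro h
  have := hst _ (normalize_mem_states hX h0)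
  rw [map_real_smul, h, smul_zero] at this
  exact ne_zero_of_mem_states this rfl

lemma IsIrreducibleInstrument.isFaithfulMap {ψ : A → SuperOp d}
    (h : IsIrreducibleInstrument ψ) : IsFaithfulMap (channel ψ) :=
  ⟨h.cptp.1.1, fun _ => h.cptp.1.1.posDef_of_irreducible
    (fun _ => ne_zero_of_preserves_states h.cptp.2) h.irreducible,
    fun _ => ne_zero_of_preserves_states h.cptp.2⟩

lemma deformed_apply (ψ : A → SuperOp d) (f : A → ℝ) (α : ℝ) (X : Mat d) :
    deformed ψ f α X = ∑ a, Real.exp (-α * f a) • ψ a X := by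
  simp only [deformed, LinearMap.sum_apply, LinearMap.smul_apply, Complex.coe_smul]

lemma channel_apply (ψ : A → SuperOp d) (X : Mat d) : channel ψ X = ∑ a, ψ a X := by
  simp [channel]

lemma isPositive_deformed {ψ : A → SuperOp d} (hψ : ∀ a, IsPositive (ψ a)) (f : A → ℝ) (α : ℝ) :
    IsPositive (deformed ψ f α) := fun X hX => by
  rw [deformed_apply]
  exact Matrix.posSemidef_sum _ fun a _ => psd_smul (Real.exp_pos _).le (hψ a X hX)

lemma deformed_sub_channel_psd {ψ : A → SuperOp d} (hψ : ∀ a, IsPositive (ψ a)) {f : A → ℝ}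
    {α M : ℝ} (hM : ∀ a, |α * f a| ≤ M) {X : Mat d} (hX : X.PosSemidef) :
    (deformed ψ f α X - Real.exp (-M) • channel ψ X).PosSemidef := by
  rw [deformed_apply, channel_apply, Finset.smul_sum, ← Finset.sum_sub_distrib]
  refine Matrix.posSemidef_sum _ fun a _ => ?_
  rw [← sub_smul]
  refine psd_smul (sub_nonneg.2 (Real.exp_le_exp.2 ?_)) (hψ a X hX)
  linarith [le_of_abs_le (hM a)]

lemma channel_sub_deformed_psd {ψ : A → SuperOp d} (hψ : ∀ a, IsPositive (ψ a)) {f : A → ℝ}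
    {α M : ℝ} (hM : ∀ a, |α * f a| ≤ M) {X : Mat d} (hX : X.PosSemidef) :
    (Real.exp M • channel ψ X - deformed ψ f α X).PosSemidef := by
  rw [deformed_apply, channel_apply, Finset.smul_sum, ← Finset.sum_sub_distrib]
  refine Matrix.posSemidef_sum _ fun a _ => ?_
  rw [← sub_smul]
  refine psd_smul (sub_nonneg.2 (Real.exp_le_exp.2 ?_)) (hψ a X hX)
  linarith [neg_le_of_abs_le (hM a)]

lemma IsIrreducibleInstrument.isPositive {ψ : A → SuperOp d} (h : IsIrreducibleInstrument ψ)
    (a : A) : IsPositive (ψ a) := (h.completelyPositive a).1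

lemma IsIrreducibleInstrument.isFaithfulMap_deformed {ψ : A → SuperOp d}
    (h : IsIrreducibleInstrument ψ) (f : A → ℝ) (α : ℝ) : IsFaithfulMap (deformed ψ f α) :=
  h.isFaithfulMap.of_comparable (isPositive_deformed h.isPositive f α) (Real.exp_pos _)
    fun _ hX => deformed_sub_channel_psd h.isPositive (M := ∑ a, |α * f a|)
      (fun a => Finset.single_le_sum (f := fun a => |α * f a|) (fun _ _ => abs_nonneg _)
        (Finset.mem_univ a)) hX

end Deformed

/-! ### Compositions along an orbit -/

section Composition

variable {Ω : Type*}

lemma composition_add (θ : Ω → Ω) (φ : Ω → SuperOp d) (m n : ℕ) (ω : Ω) :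
    composition θ φ (m + n) ω = composition θ φ n (θ^[m] ω) * composition θ φ m ω := by
  induction n with
  | zero => exact (one_mul _).symm
  | succ n ih =>
    rw [← add_assoc, composition, composition, ih, mul_assoc, ← Function.iterate_add_apply,
      add_comm n m]

/-- Past products use the family shifted by `θ`, so that their last factor sits at `ω` itself; this
translates back to the unshifted family of (A2). -/
lemma composition_comp (θ : Ω → Ω) (φ : Ω → SuperOp d) (n : ℕ) (ω : Ω) :
    composition θ (fun ω => φ (θ ω)) n ω = composition θ φ n (θ ω) := by
  induction n with
  | zero => rfl
  | succ n ih =>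
    rw [composition, composition, ih, ← Function.iterate_succ_apply, Function.iterate_succ_apply']

lemma isFaithfulMap_composition {θ : Ω → Ω} {φ : Ω → SuperOp d} (h : ∀ ω, IsFaithfulMap (φ ω))
    (n : ℕ) (ω : Ω) : IsFaithfulMap (composition θ φ n ω) := by
  induction n with
  | zero => exact .one
  | succ n ih => exact (h _).mul ih

lemma composition_mem_states {θ : Ω → Ω} {φ : Ω → SuperOp d}
    (h : ∀ ω, ∀ X ∈ states d, φ ω X ∈ states d)
    (n : ℕ) (ω : Ω) : ∀ X ∈ states d, composition θ φ n ω X ∈ states d := by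
  induction n with
  | zero => exact fun X hX => hX
  | succ n ih => exact fun X hX => h _ _ (ih X hX)

/-- With `T` and `T₀` the `n`-step products, the next difference splits as `(φ - c φ₀)(T X) + c φ₀(T
X - c^n T₀ X)`, both in the cone. -/
lemma composition_lower {θ : Ω → Ω} {φ₀ φ : Ω → SuperOp d} (h₀ : ∀ ω, IsPositive (φ₀ ω))
    (h : ∀ ω, IsFaithfulMap (φ ω)) {c : ℝ} (hc : 0 ≤ c) (n : ℕ) (ω : Ω)
    (hle : ∀ j < n, ∀ X : Mat d, X.PosSemidef →
      (φ (θ^[j] ω) X - c • φ₀ (θ^[j] ω) X).PosSemidef) {X : Mat d} (hX : X.PosSemidef) :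
    (composition θ φ n ω X - c ^ n • composition θ φ₀ n ω X).PosSemidef := by
  induction n with
  | zero => simpa [composition] using Matrix.PosSemidef.zero
  | succ n ih =>
    have ih := ih fun j hj => hle j (by omega)
    convert (hle n n.lt_succ_self _ ((isFaithfulMap_composition h n ω).pos X hX)).add
      (psd_smul hc (h₀ (θ^[n] ω) _ ih)) using 1
    rw [map_sub, map_real_smul, composition, composition, Module.End.mul_apply,
      Module.End.mul_apply]
    module

lemma composition_upper {θ : Ω → Ω} {φ₀ φ : Ω → SuperOp d} (h₀ : ∀ ω, IsPositive (φ₀ ω))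
    (h : ∀ ω, IsFaithfulMap (φ ω)) {C : ℝ} (hC : 0 ≤ C) (n : ℕ) (ω : Ω)
    (hle : ∀ j < n, ∀ X : Mat d, X.PosSemidef →
      (C • φ₀ (θ^[j] ω) X - φ (θ^[j] ω) X).PosSemidef) {X : Mat d} (hX : X.PosSemidef) :
    (C ^ n • composition θ φ₀ n ω X - composition θ φ n ω X).PosSemidef := by
  induction n with
  | zero => simpa [composition] using Matrix.PosSemidef.zero
  | succ n ih =>
    have ih := ih fun j hj => hle j (by omega)
    convert (hle n n.lt_succ_self _ ((isFaithfulMap_composition h n ω).pos X hX)).add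
      (psd_smul hC (h₀ (θ^[n] ω) _ ih)) using 1
    rw [map_sub, map_real_smul, composition, composition, Module.End.mul_apply,
      Module.End.mul_apply]
    module

end Composition

/-! ### Past products and loss of memory -/

section Past

variable {Ω : Type*} [MeasurableSpace Ω] (θ : Ω ≃ᵐ Ω)

/-- `φ_ω ∘ φ_{θ⁻¹ω} ∘ ⋯ ∘ φ_{θ^{-(n-1)}ω}`. -/
def past (φ : Ω → SuperOp d) (n : ℕ) (ω : Ω) : SuperOp d :=
  composition θ (fun ω => φ (θ ω)) n (θ.symm^[n] ω)

lemma past_add (φ : Ω → SuperOp d) (n m : ℕ) (ω : Ω) :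
    past θ φ (n + m) ω = past θ φ n ω * past θ φ m (θ.symm^[n] ω) := by
  have hinv : Function.LeftInverse θ^[m] θ.symm^[m] :=
    Function.LeftInverse.iterate θ.apply_symm_apply m
  rw [past, past, past, add_comm n m, composition_add, Function.iterate_add_apply,
    hinv (θ.symm^[n] ω)]

lemma past_zero (φ : Ω → SuperOp d) (ω : Ω) : past θ φ 0 ω = 1 := rfl

lemma past_one (φ : Ω → SuperOp d) (ω : Ω) : past θ φ 1 ω = φ ω := by
  simp [past, composition]

lemma past_succ (φ : Ω → SuperOp d) (n : ℕ) (ω : Ω) :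
    past θ φ (n + 1) ω = past θ φ n ω * φ (θ.symm^[n] ω) := by rw [past_add, past_one]

lemma past_succ' (φ : Ω → SuperOp d) (n : ℕ) (ω : Ω) :
    past θ φ (n + 1) ω = φ ω * past θ φ n (θ.symm ω) := by
  rw [add_comm, past_add, past_one]; rfl

variable {θ}

lemma isFaithfulMap_past {φ : Ω → SuperOp d} (h : ∀ ω, IsFaithfulMap (φ ω)) (n : ℕ) (ω : Ω) :
    IsFaithfulMap (past θ φ n ω) := isFaithfulMap_composition (fun _ => h _) n _

lemma frequently_shift {G : Set Ω} {ω : Ω} (h : ∃ᶠ n in atTop, θ.symm^[n] ω ∈ G) (k : ℕ) :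
    ∃ᶠ n in atTop, θ.symm^[n] (θ.symm^[k] ω) ∈ G := by
  rw [← map_add_atTop_eq_nat k, frequently_map] at h
  exact h.mono fun n hn => by rwa [← Function.iterate_add_apply]

/-- An orbit whose past visits `G` infinitely often contracts, uniformly in the index `i`. -/
theorem exists_past_close {ι : Type*} {φ : ι → Ω → SuperOp d} (hφ : ∀ i ω, IsFaithfulMap (φ i ω))
    {G : Set Ω} {N : ℕ} {η : ℝ} (hη : 0 < η) (hη1 : η ≤ 1)
    (hG : ∀ i, ∀ ω ∈ G, IsMixing η (composition θ (fun ω => φ i (θ ω)) N ω)) (k : ℕ) :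
    ∀ ω, (∃ᶠ n in atTop, θ.symm^[n] ω ∈ G) → ∃ n₀, ∀ n ≥ n₀, ∀ i, ∀ X Y : Mat d,
      X.PosSemidef → X ≠ 0 → Y.PosSemidef → Y ≠ 0 →
      Close ((1 - η) ^ k * η⁻¹ ^ 2) (past θ (φ i) n ω X) (past θ (φ i) n ω Y) := by
  -- A visit to `G` at time `-n` mixes over the next `N` steps, which all lie in the past of `ω`
  -- only if `n ≥ N`.
  have key : ∀ ω n, N ≤ n → ∀ i, past θ (φ i) n ω = past θ (φ i) (n - N) ω *
      composition θ (fun ω => φ i (θ ω)) N (θ.symm^[n] ω) := by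
    intro ω n hn i
    obtain ⟨m, rfl⟩ := Nat.exists_eq_add_of_le' hn
    rw [past_add, Nat.add_sub_cancel, past.eq_1 θ (φ i) N, ← Function.iterate_add_apply,
      add_comm N m]
  induction k with
  | zero =>
    intro ω h
    obtain ⟨n, hn, hnG⟩ := (frequently_atTop.1 h) N
    refine ⟨n, fun n' hn' i X Y hX hX0 hY hY0 => ?_⟩
    obtain ⟨m, rfl⟩ := Nat.exists_eq_add_of_le hn'
    have hm := isFaithfulMap_past (hφ i) (θ := θ) m (θ.symm^[n] ω)
    rw [past_add, key ω n hn, pow_zero, one_mul]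
    exact ((hG i _ hnG).close hη (hm.pos X hX) (hm.ne_zero X hX hX0) (hm.pos Y hY)
      (hm.ne_zero Y hY hY0)).map (isFaithfulMap_past (hφ i) _ _).pos
  | succ k ih =>
    intro ω h
    obtain ⟨n, hn, hnG⟩ := (frequently_atTop.1 h) N
    -- The induction hypothesis is used at the visited point: the older maps act first and supply
    -- `k` contractions, and the block starting at the visit supplies one more.
    obtain ⟨m₀, hm₀⟩ := ih _ (frequently_shift h n)
    refine ⟨n + m₀, fun n' hn' i X Y hX hX0 hY hY0 => ?_⟩
    obtain ⟨m, rfl⟩ := Nat.exists_eq_add_of_le ((Nat.le_add_right n m₀).trans hn')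
    have hm := isFaithfulMap_past (hφ i) (θ := θ) m (θ.symm^[n] ω)
    rw [past_add, key ω n hn, pow_succ', mul_assoc]
    exact ((hm₀ m (by omega) i X Y hX hX0 hY hY0).map_mixing hη hη1
      (mul_nonneg (pow_nonneg (by linarith) k) (by positivity)) (hG i _ hnG) (hm.pos X hX)
      (hm.ne_zero X hX hX0)).map (isFaithfulMap_past (hφ i) _ _).pos

/-- The normalized past compositions forget their initial condition, uniformly in `i`. -/
theorem exists_past_dist_le {ι : Type*} {φ : ι → Ω → SuperOp d}
    (hφ : ∀ i ω, IsFaithfulMap (φ i ω))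
    {G : Set Ω} {N : ℕ} {η : ℝ} (hη : 0 < η) (hη1 : η ≤ 1)
    (hG : ∀ i, ∀ ω ∈ G, IsMixing η (composition θ (fun ω => φ i (θ ω)) N ω))
    {ω : Ω} (hω : ∃ᶠ n in atTop, θ.symm^[n] ω ∈ G) {ε : ℝ} (hε : 0 < ε) :
    ∃ n₀, ∀ n ≥ n₀, ∀ i, ∀ X Y : Mat d,
      X.PosSemidef → X ≠ 0 → Y.PosSemidef → Y ≠ 0 → ∀ p q,
      ‖projAct (past θ (φ i) n ω) X p q - projAct (past θ (φ i) n ω) Y p q‖ ≤ ε := by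
  have hlim : Tendsto (fun k : ℕ => 2 * ((1 - η) ^ k * η⁻¹ ^ 2)) atTop (𝓝 0) := by
    simpa only [zero_mul, mul_zero] using ((tendsto_pow_atTop_nhds_zero_of_lt_one
      (by linarith : 0 ≤ 1 - η)
      (by linarith)).mul_const (η⁻¹ ^ 2)).const_mul 2
  obtain ⟨k, hk⟩ := (hlim.eventually (gt_mem_nhds hε)).exists
  obtain ⟨n₀, h⟩ := exists_past_close hφ hη hη1 hG k ω hω
  refine ⟨n₀, fun n hn i X Y hX hX0 hY hY0 p q => ?_⟩
  have hp := isFaithfulMap_past (hφ i) (θ := θ) n ω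
  rw [projAct_eq hp.pos hX, projAct_eq hp.pos hY]
  exact ((h n hn i X Y hX hX0 hY hY0).norm_sub_le (hp.pos X hX) (hp.ne_zero X hX hX0) p q).trans
    hk.le

/-- Iterating equivariance backwards. Values are only required to be states, so that this applies to
the limit object before its positive definiteness is known. -/
lemma eq_projAct_past {φ : Ω → SuperOp d} (hφ : ∀ ω, IsFaithfulMap (φ ω)) {W : Ω → Mat d}
    {ω : Ω} (hW : ∀ n, W (θ.symm^[n] ω) ∈ states d)
    (h : ∀ n, projAct (φ (θ.symm^[n] ω)) (W (θ.symm (θ.symm^[n] ω))) = W (θ.symm^[n] ω))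
    (n : ℕ) : W ω = projAct (past θ φ n ω) (W (θ.symm^[n] ω)) := by
  induction n with
  | zero =>
    have h1 : (W ω).trace = 1 := (hW 0).2
    simp [past_zero, projAct, h1]
  | succ n ih =>
    rw [past_succ, projAct_mul (hφ _) (hW _).1 (ne_zero_of_mem_states (hW _)),
      Function.iterate_succ_apply', h]
    exact ih

lemma mem_states_of_mem_faithfulStates {X : Mat d} (hX : X ∈ faithfulStates d) : X ∈ states d :=
  ⟨hX.1.posSemidef, hX.2⟩

lemma IsEquivariantAt.eq_past {φ : Ω → SuperOp d} (hφ : ∀ ω, IsFaithfulMap (φ ω)) {W : Ω → Mat d}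
    {ω : Ω} (h : ∀ n, IsEquivariantAt θ φ W (θ.symm^[n] ω)) (n : ℕ) :
    W ω = projAct (past θ φ n ω) (W (θ.symm^[n] ω)) :=
  eq_projAct_past hφ (fun n => mem_states_of_mem_faithfulStates (h n).1) (fun n => (h n).2) n

end Past

/-! ### Measurability -/

section Measurability

variable {Ω : Type*} [MeasurableSpace Ω]

lemma apply_eq_sum (Ψ : SuperOp d) (X : Mat d) (p q : Fin d) :
    Ψ X p q = ∑ i, ∑ j, X i j * Ψ (Matrix.single i j 1) p q := by
  conv_lhs => rw [Matrix.matrix_eq_sum_single X]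
  simp only [map_sum, Matrix.sum_apply]
  refine Finset.sum_congr rfl fun i _ => Finset.sum_congr rfl fun j _ => ?_
  rw [← smul_eq_mul, ← Matrix.smul_apply, ← map_smul, Matrix.smul_single, smul_eq_mul, mul_one]

lemma MeasurableMat.map {Ψ : Ω → SuperOp d} (hΨ : ∀ X, MeasurableMat fun ω => Ψ ω X)
    {X : Ω → Mat d} (hX : MeasurableMat X) : MeasurableMat fun ω => Ψ ω (X ω) := fun p q => by
  simp only [fun ω => apply_eq_sum (Ψ ω) (X ω) p q]
  exact Finset.measurable_sum _ fun i _ => Finset.measurable_sum _ fun j _ =>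
    (hX i j).mul (hΨ _ p q)

lemma measurableMat_projAct {Ψ : Ω → SuperOp d} (hΨ : ∀ X, MeasurableMat fun ω => Ψ ω X)
    (X : Mat d) : MeasurableMat fun ω => projAct (Ψ ω) X := fun p q => by
  simp only [projAct, Matrix.smul_apply, Matrix.trace, Matrix.diag_apply, smul_eq_mul]
  exact (Finset.measurable_sum _ fun i _ => hΨ X i i).inv.mul (hΨ X p q)

lemma measurableMat_composition {θ : Ω → Ω} (hθ : Measurable θ) {φ : Ω → SuperOp d}
    (hφ : ∀ X, MeasurableMat fun ω => φ ω X) (n : ℕ) (X : Mat d) :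
    MeasurableMat fun ω => composition θ φ n ω X := by
  induction n with
  | zero => exact fun _ _ => measurable_const
  | succ n ih =>
    exact MeasurableMat.map (fun X p q => (hφ X p q).comp (hθ.iterate n)) ih

lemma measurableMat_past {θ : Ω ≃ᵐ Ω} {φ : Ω → SuperOp d}
    (hφ : ∀ X, MeasurableMat fun ω => φ ω X) (n : ℕ) (X : Mat d) :
    MeasurableMat fun ω => past θ φ n ω X := fun p q =>
  (measurableMat_composition θ.measurable (fun X p q => (hφ X p q).comp θ.measurable) n X p q).comp
    (θ.symm.measurable.iterate n)

lemma measurableMat_deformed {A : Type*} [Fintype A] {ψ : Ω → A → SuperOp d}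
    (hψ : ∀ (a : A) (X : Mat d), MeasurableMat fun ω => ψ ω a X)
    {f : Ω → A → ℝ} (hf : ∀ a, Measurable fun ω => f ω a) (α : ℝ) (X : Mat d) :
    MeasurableMat fun ω => deformed (ψ ω) (f ω) α X := fun p q => by
  simp only [deformed_apply, Matrix.sum_apply, Matrix.smul_apply]
  exact Finset.measurable_sum _ fun a _ => ((hf a).const_mul (-α)).exp.smul (hψ a X p q)

lemma measurableMat_channel {A : Type*} [Fintype A] {ψ : Ω → A → SuperOp d}
    (hψ : ∀ (a : A) (X : Mat d), MeasurableMat fun ω => ψ ω a X) (X : Mat d) :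
    MeasurableMat fun ω => channel (ψ ω) X := fun p q => by
  simp only [channel_apply, Matrix.sum_apply]
  exact Finset.measurable_sum _ fun a _ => hψ a X p q

/-- Mixing quantifies over uncountably many pairs, but it is a closed condition on the finitely many
entries that determine `Ψ`. -/
lemma measurableSet_isMixing {Ψ : Ω → SuperOp d} (hΨ : ∀ X, MeasurableMat fun ω => Ψ ω X)
    (η : ℝ) : MeasurableSet {ω | IsMixing η (Ψ ω)} := by
  let L : (Fin d × Fin d × Fin d × Fin d → ℂ) → Mat d → Mat d := fun T X =>
    Matrix.of fun p q => ∑ i, ∑ j, X i j * T (i, j, p, q)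
  have hL : ∀ X, Continuous fun T => L T X := fun X => by
    refine continuous_matrix fun p q => ?_
    simp only [L, Matrix.of_apply]
    fun_prop
  have hclosed : IsClosed {T | ∀ X Y : Mat d, X.PosSemidef → Y.PosSemidef →
      (tr X • L T Y - (η * tr Y) • L T X).PosSemidef} := by
    simp only [Set.ofPred_forall]
    exact isClosed_iInter fun X => isClosed_iInter fun Y => isClosed_iInter fun _ =>
      isClosed_iInter fun _ => isClosed_psd.preimage
        (((hL Y).const_smul (tr X)).sub ((hL X).const_smul (η * tr Y)))
  have hmeas : Measurable fun ω => fun t : Fin d × Fin d × Fin d × Fin d =>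
      Ψ ω (Matrix.single t.1 t.2.1 1) t.2.2.1 t.2.2.2 :=
    measurable_pi_iff.2 fun t => hΨ _ _ _
  have hLΨ : ∀ ω X, L (fun t => Ψ ω (Matrix.single t.1 t.2.1 1) t.2.2.1 t.2.2.2) X = Ψ ω X := fun ω X => by
    ext p q
    exact (apply_eq_sum (Ψ ω) X p q).symm
  convert hmeas hclosed.measurableSet using 1
  ext ω
  simp only [Set.mem_preimage, Set.mem_ofPred_eq, hLΨ]
  rfl

end Measurability

/-! ### Recurrence to a set of uniform mixing -/

section Recurrence

variable {Ω : Type*} [MeasurableSpace Ω] {P : Measure Ω} [IsProbabilityMeasure P] {θ : Ω ≃ᵐ Ω}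

/-- The set of points visiting `G` infinitely often is invariant under `θ⁻¹`, hence null or of full
measure. Poincaré recurrence puts almost all of `G` in it, so it is not null. -/
lemma ae_frequently_past_mem (hθ : Ergodic θ P) {G : Set Ω} (hG : MeasurableSet G)
    (hpos : P G ≠ 0) : ∀ᵐ ω ∂P, ∃ᶠ n in atTop, θ.symm^[n] ω ∈ G := by
  have hmeas : MeasurableSet {ω | ∃ᶠ n in atTop, θ.symm^[n] ω ∈ G} := by
    simp only [frequently_atTop, Set.ofPred_forall, Set.ofPred_exists, Set.ofPred_and]
    exact MeasurableSet.iInter fun m => MeasurableSet.iUnion fun n =>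
      (MeasurableSet.const _).inter ((θ.symm.measurable.iterate n) hG)
  have hinv : θ.symm ⁻¹' {ω | ∃ᶠ n in atTop, θ.symm^[n] ω ∈ G} =
      {ω | ∃ᶠ n in atTop, θ.symm^[n] ω ∈ G} := by
    ext ω
    have h : (∃ᶠ n in atTop, θ.symm^[n] ω ∈ G) ↔ ∃ᶠ n in atTop, θ.symm^[n + 1] ω ∈ G := by
      conv_lhs => rw [← map_add_atTop_eq_nat 1, frequently_map]
    exact h.symm
  rcases hθ.symm.toPreErgodic.ae_mem_or_ae_notMem hmeas hinv with h | h
  · exact h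
  · refine absurd (measure_eq_zero_iff_ae_notMem.2 ?_) hpos
    filter_upwards [h, hθ.symm.toMeasurePreserving.conservative.ae_mem_imp_frequently_image_mem
      hG.nullMeasurableSet] with ω h1 h2 h3 using h1 (h2 h3)

variable {A : Type*} [Fintype A]

/-- The points where the next `N` steps of the undeformed cocycle are quantitatively mixing, with
bounded weights `f`. -/
def mixingSet (θ : Ω ≃ᵐ Ω) (ψ : Ω → A → SuperOp d) (f : Ω → A → ℝ) (N k : ℕ) : Set Ω :=
  {ω | IsMixing (1 / ((k : ℝ) + 1)) (composition θ (fun ω => channel (ψ (θ ω))) N ω) ∧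
    ∀ j < N, ∀ a, |f (θ (θ^[j] ω)) a| ≤ k}

lemma measurableSet_mixingSet {ψ : Ω → A → SuperOp d}
    (hψ : ∀ (a : A) (X : Mat d), MeasurableMat fun ω => ψ ω a X)
    {f : Ω → A → ℝ} (hf : ∀ a, Measurable fun ω => f ω a) (N k : ℕ) :
    MeasurableSet (mixingSet θ ψ f N k) := by
  have h1 : MeasurableSet {ω | ∀ j < N, ∀ a, |f (θ (θ^[j] ω)) a| ≤ k} := by
    simp only [Set.ofPred_forall]
    refine MeasurableSet.iInter fun j => MeasurableSet.iInter fun _ =>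
      MeasurableSet.iInter fun a => measurableSet_le ?_ measurable_const
    exact ((hf a).comp (θ.measurable.comp (θ.measurable.iterate j))).abs
  exact (measurableSet_isMixing (measurableMat_composition θ.measurable
    (fun X p q => (measurableMat_channel hψ X p q).comp θ.measurable) N) _).inter h1

lemma exists_ae_frequently_mixingSet (hθ : Ergodic θ P) {ψ : Ω → A → SuperOp d}
    (hψ_meas : ∀ (a : A) (X : Mat d), MeasurableMat fun ω => ψ ω a X)
    (hψ : ∀ ω, IsIrreducibleInstrument (ψ ω))
    {f : Ω → A → ℝ} (hf : ∀ a, Measurable fun ω => f ω a) {N : ℕ}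
    (hpos : 0 < P {ω | IsPositivityImproving (composition θ (fun ω' => channel (ψ ω')) N ω)}) :
    ∃ k, ∀ᵐ ω ∂P, ∃ᶠ n in atTop, θ.symm^[n] ω ∈ mixingSet θ ψ f N k := by
  by_contra! hcon
  have hnull : ∀ k, P (mixingSet θ ψ f N k) = 0 := fun k => by
    by_contra h
    exact hcon k (ae_frequently_past_mem hθ (measurableSet_mixingSet hψ_meas hf N k) h)
  -- The event of (A2), pulled back by `θ` to match the shifted cocycle, is covered by the mixing
  -- sets over all `k`; they cannot all be null.
  rw [← hθ.toMeasurePreserving.measure_preimage_equiv] at hpos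
  refine hpos.ne' (measure_mono_null (fun ω hω => ?_) (measure_iUnion_null hnull))
  have hω' : IsPositivityImproving (composition θ (fun ω => channel (ψ (θ ω))) N ω) := by
    rw [composition_comp θ fun ω => channel (ψ ω)]
    exact hω
  obtain ⟨η, hη, hmix⟩ := hω'.exists_isMixing
    (composition_mem_states (fun ω => (hψ (θ ω)).cptp.2) N ω)
  obtain ⟨k₁, hk₁⟩ := exists_nat_one_div_lt hη
  obtain ⟨k₂, hk₂⟩ := exists_nat_ge (∑ j ∈ Finset.range N, ∑ a, |f (θ (θ^[j] ω)) a|)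
  refine Set.mem_iUnion.2 ⟨max k₁ k₂, hmix.mono
    (isFaithfulMap_composition (fun ω => (hψ (θ ω)).isFaithfulMap) N ω).pos ?_, fun j hj a => ?_⟩
  · refine le_trans (one_div_le_one_div_of_le (by positivity) ?_) hk₁.le
    gcongr
    exact le_max_left _ _
  · calc |f (θ (θ^[j] ω)) a| ≤ ∑ a, |f (θ (θ^[j] ω)) a| :=
          Finset.single_le_sum (f := fun a => |f (θ (θ^[j] ω)) a|) (fun _ _ => abs_nonneg _)
            (Finset.mem_univ a)
      _ ≤ ∑ j ∈ Finset.range N, ∑ a, |f (θ (θ^[j] ω)) a| :=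
          Finset.single_le_sum (f := fun j => ∑ a, |f (θ (θ^[j] ω)) a|)
            (fun _ _ => Finset.sum_nonneg fun _ _ => abs_nonneg _) (Finset.mem_range.2 hj)
      _ ≤ k₂ := hk₂
      _ ≤ _ := Nat.cast_le.2 (le_max_right _ _)

/-- On the mixing set the deformed cocycles mix uniformly for bounded `α`. -/
lemma exists_isMixing_deformed {ψ : Ω → A → SuperOp d}
    (hψ : ∀ ω, IsIrreducibleInstrument (ψ ω)) (f : Ω → A → ℝ) (N k : ℕ) (R : ℝ) :
    ∃ η : ℝ, 0 < η ∧ η ≤ 1 ∧ ∀ α : ℝ, |α| ≤ R → ∀ ω ∈ mixingSet θ ψ f N k,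
      IsMixing η (composition θ (fun ω => deformed (ψ (θ ω)) (f (θ ω)) α) N ω) := by
  -- Each step costs `e^{-Rk}` from below and `e^{Rk}` from above, hence the `N`-th powers around
  -- the undeformed constant.
  refine ⟨min 1 (Real.exp (-(R * k)) ^ N * (1 / ((k : ℝ) + 1)) / Real.exp (R * k) ^ N),
    lt_min one_pos (by positivity), min_le_left _ _, fun α hα ω hω => ?_⟩
  have hfaith := fun ω => (hψ (θ ω)).isFaithfulMap_deformed (f (θ ω)) α
  have hchan := fun ω => (hψ (θ ω)).isFaithfulMap.pos
  have hb : ∀ j < N, ∀ a, |α * f (θ (θ^[j] ω)) a| ≤ R * k := fun j hj a => by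
    rw [abs_mul]
    exact mul_le_mul hα (hω.2 j hj a) (abs_nonneg _) ((abs_nonneg _).trans hα)
  refine (IsMixing.of_comparable (by positivity) (by positivity) (by positivity) hω.1
    (fun X hX => ?_) (fun X hX => ?_)).mono (isFaithfulMap_composition hfaith N ω).pos
    (min_le_right _ _)
  · exact composition_lower hchan hfaith (Real.exp_pos _).le N ω
      (fun j hj X hX => deformed_sub_channel_psd (hψ _).isPositive (hb j hj) hX) hX
  · exact composition_upper hchan hfaith (Real.exp_pos _).le N ω
      (fun j hj X hX => channel_sub_deformed_psd (hψ _).isPositive (hb j hj) hX) hX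

end Recurrence

/-! ### Entrywise convergence implies convergence in both metrics -/

section Metrics

lemma traceNorm_le (X : Mat d) : traceNorm X ≤ d * Real.sqrt (tr (X.conjTranspose * X)) := by
  have hpsd := Matrix.posSemidef_conjTranspose_mul_self X
  have hH := Matrix.isHermitian_conjTranspose_mul_self X
  have htr : tr (X.conjTranspose * X) = ∑ i, hH.eigenvalues i := by
    rw [tr, hH.trace_eq_sum_eigenvalues]
    simp
  calc traceNorm X ≤ ∑ _i : Fin d, Real.sqrt (tr (X.conjTranspose * X)) :=
        Finset.sum_le_sum fun i _ => Real.sqrt_le_sqrt (by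
          rw [htr]
          exact Finset.single_le_sum (f := hH.eigenvalues)
            (fun i _ => hpsd.eigenvalues_nonneg i) (Finset.mem_univ i))
    _ = d * Real.sqrt (tr (X.conjTranspose * X)) := by simp

lemma traceNorm_nonneg (X : Mat d) : 0 ≤ traceNorm X :=
  Finset.sum_nonneg fun _ _ => Real.sqrt_nonneg _

lemma tendsto_traceNorm_sub {ι : Type*} {l : Filter ι} {X : ι → Mat d} {Y : Mat d}
    (h : Tendsto X l (𝓝 Y)) : Tendsto (fun i => traceNorm (X i - Y)) l (𝓝 0) := by
  have hc : Continuous fun X : Mat d => d * Real.sqrt (tr ((X - Y).conjTranspose * (X - Y))) := by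
    refine continuous_const.mul (Real.continuous_sqrt.comp (continuous_tr.comp ?_))
    fun_prop
  have := (hc.tendsto Y).comp h
  simp only [sub_self, tr, Matrix.trace_zero, Complex.zero_re, Real.sqrt_zero,
    mul_zero] at this
  exact squeeze_zero (fun _ => traceNorm_nonneg _) (fun i => traceNorm_le _) this

lemma mCoeff_bdd {X Y : Mat d} (hX : X ∈ states d) (hY : Y ∈ states d) {c : ℝ}
    (h : (Y - (c : ℂ) • X).PosSemidef) : c ≤ 1 := by
  rw [Complex.coe_smul] at h
  have := tr_nonneg h
  rw [tr_sub, tr_smul, (mem_states_iff.1 hX).2, (mem_states_iff.1 hY).2] at this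
  linarith

lemma mCoeff_le_one {X Y : Mat d} (hX : X ∈ states d) (hY : Y ∈ states d) : mCoeff X Y ≤ 1 :=
  Real.sSup_le (fun _ hc => mCoeff_bdd hX hY hc.2) zero_le_one

lemma mCoeff_nonneg (X Y : Mat d) : 0 ≤ mCoeff X Y := Real.sSup_nonneg fun _ hc => hc.1

lemma le_mCoeff {X Y : Mat d} (hX : X ∈ states d) (hY : Y ∈ states d) {c : ℝ} (hc : 0 ≤ c)
    (h : (Y - c • X).PosSemidef) : c ≤ mCoeff X Y :=
  le_csSup ⟨1, fun _ hc => mCoeff_bdd hX hY hc.2⟩ ⟨hc, by rwa [Complex.coe_smul]⟩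

lemma projDist_nonneg {X Y : Mat d} (hX : X ∈ states d) (hY : Y ∈ states d) :
    0 ≤ projDist X Y := by
  have h1 := mul_le_one₀ (mCoeff_le_one hX hY) (mCoeff_nonneg Y X) (mCoeff_le_one hY hX)
  have h2 := mul_nonneg (mCoeff_nonneg X Y) (mCoeff_nonneg Y X)
  exact div_nonneg (by linarith) (by linarith)

/-- Both coefficients are at least `1 - t`, so the numerator is at most `1 - (1 - t)² ≤ 2t`, and the
denominator is at least one. -/
lemma projDist_le {X Y : Mat d} (hX : X ∈ states d) (hY : Y ∈ states d) {t : ℝ} (ht : t ≤ 1)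
    (h1 : (Y - (1 - t) • X).PosSemidef) (h2 : (X - (1 - t) • Y).PosSemidef) :
    projDist X Y ≤ 2 * t := by
  have m1 := le_mCoeff hX hY (by linarith) h1
  have m2 := le_mCoeff hY hX (by linarith) h2
  have hm := mul_le_mul m1 m2 (by linarith) (mCoeff_nonneg X Y)
  have h0 := mul_nonneg (mCoeff_nonneg X Y) (mCoeff_nonneg Y X)
  have hle := mul_le_one₀ (mCoeff_le_one hX hY) (mCoeff_nonneg Y X) (mCoeff_le_one hY hX)
  rw [projDist]
  refine (div_le_self (by linarith) (by linarith)).trans ?_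
  nlinarith [sq_nonneg t]

lemma tendsto_projDist {ι : Type*} {l : Filter ι} {X : ι → Mat d} {Y : Mat d}
    (hX : ∀ i, X i ∈ states d) (hY : Y ∈ faithfulStates d)
    (h : Tendsto X l (𝓝 Y)) : Tendsto (fun i => projDist (X i) Y) l (𝓝 0) := by
  have hYs : Y ∈ states d := mem_states_of_mem_faithfulStates hY
  obtain ⟨ε, hε, hεY⟩ := exists_lower_bound hY.1
  rw [Metric.tendsto_nhds]
  intro s hs
  set t := min (s / 4) 1 with ht
  have ht0 : 0 < t := lt_min (by linarith) one_pos
  have ht1 : t ≤ 1 := min_le_right _ _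
  -- Chosen so that an entrywise error `r`, of size at most `d r • 1` in the cone order, is absorbed
  -- by `t ε • 1 ≤ t Y`. Only the limit `Y` needs a lower bound.
  set r := t * ε / (d + 1) with hr
  have hr0 : 0 < r := by positivity
  have hclose : ∀ᶠ i in l, ∀ p q, ‖X i p q - Y p q‖ ≤ r := by
    refine eventually_all.2 fun p => eventually_all.2 fun q => ?_
    have hpq : Tendsto (fun i => X i p q) l (𝓝 (Y p q)) :=
      tendsto_pi_nhds.1 (tendsto_pi_nhds.1 h p) q
    filter_upwards [Metric.tendsto_nhds.1 hpq r hr0] with i hi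
    rw [← dist_eq_norm]
    exact hi.le
  filter_upwards [hclose] with i hi
  have hXi := hX i
  have hdr : 0 ≤ t * ε - d * r := by
    have : t * ε = (d + 1) * r := by rw [hr]; field_simp
    rw [this]
    linarith
  have hH : (X i - Y).IsHermitian := hXi.1.1.sub hYs.1.1
  have p1 : (X i - Y + (d * r) • (1 : Mat d)).PosSemidef :=
    psd_add_smul_one hH (fun p q => by simpa using hi p q) hr0.le
  have p2 : (-(X i - Y) + (d * r) • (1 : Mat d)).PosSemidef :=
    psd_add_smul_one hH.neg (fun p q => by
      rw [Matrix.neg_apply, norm_neg]; simpa using hi p q) hr0.le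
  have h1 : (Y - (1 - t) • X i).PosSemidef := by
    have h0 : 0 ≤ t * ε - (1 - t) * (d * r) := by
      have := mul_nonneg ht0.le (show (0 : ℝ) ≤ d * r by positivity)
      linarith
    convert ((psd_smul ht0.le hεY).add (psd_smul (sub_nonneg.2 ht1) p2)).add
      (psd_smul h0 Matrix.PosSemidef.one) using 1
    module
  have h2 : (X i - (1 - t) • Y).PosSemidef := by
    convert ((psd_smul ht0.le hεY).add p1).add (psd_smul hdr Matrix.PosSemidef.one) using 1
    module
  rw [dist_zero_right, Real.norm_of_nonneg (projDist_nonneg hXi hYs)]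
  refine (projDist_le hXi hYs ht1 h1 h2).trans_lt ?_
  linarith [min_le_left (s / 4) 1]

end Metrics

/-! ### Uniqueness and construction of the equivariant state -/

section Limit

variable {Ω : Type*} [MeasurableSpace Ω] {θ : Ω ≃ᵐ Ω}

/-- The normalized past compositions lose the memory of their initial condition, uniformly in
the index. -/
def IsForgetfulAt {ι : Type*} (θ : Ω ≃ᵐ Ω) (φ : ι → Ω → SuperOp d) (ω : Ω) : Prop :=
  ∀ ε > 0, ∃ n₀, ∀ n ≥ n₀, ∀ i, ∀ X Y : Mat d,
    X.PosSemidef → X ≠ 0 → Y.PosSemidef → Y ≠ 0 → ∀ p q,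
    ‖projAct (past θ (φ i) n ω) X p q - projAct (past θ (φ i) n ω) Y p q‖ ≤ ε

lemma IsForgetfulAt.eq_of_equivariant {φ : Ω → SuperOp d} (hφ : ∀ ω, IsFaithfulMap (φ ω))
    {ω : Ω} (h : IsForgetfulAt θ (fun _ : Unit => φ) ω) {W W' : Ω → Mat d}
    (hW : ∀ n, IsEquivariantAt θ φ W (θ.symm^[n] ω))
    (hW' : ∀ n, IsEquivariantAt θ φ W' (θ.symm^[n] ω)) : W ω = W' ω := by
  ext p q
  refine eq_of_forall_dist_le fun ε hε => ?_
  obtain ⟨n, hn⟩ := h ε hε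
  rw [dist_eq_norm, IsEquivariantAt.eq_past hφ hW n, IsEquivariantAt.eq_past hφ hW' n]
  have h1 : W (θ.symm^[n] ω) ∈ states d := mem_states_of_mem_faithfulStates (hW n).1
  have h2 : W' (θ.symm^[n] ω) ∈ states d := mem_states_of_mem_faithfulStates (hW' n).1
  exact hn n le_rfl () _ _ h1.1 (ne_zero_of_mem_states h1) h2.1 (ne_zero_of_mem_states h2) p q

/-- The entrywise limit of the normalized past compositions applied to the identity. -/
noncomputable def pastLimit (θ : Ω ≃ᵐ Ω) (φ : Ω → SuperOp d) (ω : Ω) : Mat d := Matrix.of fun p q =>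
  ((limsup (fun n => (projAct (past θ φ n ω) 1 p q).re) atTop : ℝ) : ℂ) +
    ((limsup (fun n => (projAct (past θ φ n ω) 1 p q).im) atTop : ℝ) : ℂ) * Complex.I

/-- Defining the limit through `limsup` of real and imaginary parts gives measurability everywhere,
with no convergence needed. -/
lemma measurableMat_pastLimit {φ : Ω → SuperOp d} (hφ : ∀ X, MeasurableMat fun ω => φ ω X) :
    MeasurableMat (pastLimit θ φ) := fun p q => by
  have h := fun n => measurableMat_projAct (measurableMat_past (θ := θ) hφ n) 1 p q
  exact (Complex.measurable_ofReal.comp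
    (Measurable.limsup fun n => Complex.measurable_re.comp (h n))).add
    ((Complex.measurable_ofReal.comp
      (Measurable.limsup fun n => Complex.measurable_im.comp (h n))).mul_const _)

/-- Lengthening the past only replaces the initial identity by another state, so loss of memory is
exactly the Cauchy property. -/
lemma IsForgetfulAt.tendsto_pastLimit (hd : (1 : Mat d) ≠ 0) {φ : Ω → SuperOp d}
    (hφ : ∀ ω, IsFaithfulMap (φ ω))
    {ω : Ω} (h : IsForgetfulAt θ (fun _ : Unit => φ) ω) :
    Tendsto (fun n => projAct (past θ φ n ω) 1) atTop (𝓝 (pastLimit θ φ ω)) := by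
  refine tendsto_pi_nhds.2 fun p => tendsto_pi_nhds.2 fun q => ?_
  have hc : CauchySeq fun n => projAct (past θ φ n ω) 1 p q := by
    refine Metric.cauchySeq_iff'.2 fun ε hε => ?_
    obtain ⟨n₀, hn⟩ := h (ε / 2) (by linarith)
    refine ⟨n₀, fun n hle => ?_⟩
    obtain ⟨m, rfl⟩ := Nat.exists_eq_add_of_le hle
    have hm := isFaithfulMap_past hφ (θ := θ) m (θ.symm^[n₀] ω)
    have hs := hm.projAct_mem Matrix.PosSemidef.one hd
    rw [dist_eq_norm, past_add, projAct_mul hm Matrix.PosSemidef.one hd]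
    exact (hn n₀ le_rfl () _ _ hs.1 (ne_zero_of_mem_states hs) Matrix.PosSemidef.one hd p
      q).trans_lt (by linarith)
  obtain ⟨z, hz⟩ := cauchySeq_tendsto_of_complete hc
  convert hz using 2
  have h1 := ((Complex.continuous_re.tendsto z).comp hz).limsup_eq
  have h2 := ((Complex.continuous_im.tendsto z).comp hz).limsup_eq
  simp only [Function.comp_def] at h1 h2
  rw [pastLimit, Matrix.of_apply, h1, h2, Complex.re_add_im]

lemma IsForgetfulAt.pastLimit_mem_states (hd : (1 : Mat d) ≠ 0) {φ : Ω → SuperOp d}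
    (hφ : ∀ ω, IsFaithfulMap (φ ω))
    {ω : Ω} (h : IsForgetfulAt θ (fun _ : Unit => φ) ω) : pastLimit θ φ ω ∈ states d :=
  isClosed_states.mem_of_tendsto (h.tendsto_pastLimit hd hφ)
    (Eventually.of_forall fun n => (isFaithfulMap_past hφ n ω).projAct_mem Matrix.PosSemidef.one hd)

lemma IsForgetfulAt.projAct_pastLimit (hd : (1 : Mat d) ≠ 0) {φ : Ω → SuperOp d}
    (hφ : ∀ ω, IsFaithfulMap (φ ω))
    {ω : Ω} (h : IsForgetfulAt θ (fun _ : Unit => φ) ω)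
    (h' : IsForgetfulAt θ (fun _ : Unit => φ) (θ.symm ω)) :
    projAct (φ ω) (pastLimit θ φ (θ.symm ω)) = pastLimit θ φ ω := by
  have hs := h'.pastLimit_mem_states hd hφ
  have hcont : Continuous (φ ω) := (φ ω).continuous_of_finiteDimensional
  have hc : ContinuousAt (projAct (φ ω)) (pastLimit θ φ (θ.symm ω)) := by
    have htr : Continuous fun X : Mat d => (φ ω X).trace := hcont.matrix_trace
    exact (htr.continuousAt.inv₀ ((hφ ω).trace_ne_zero hs.1 (ne_zero_of_mem_states hs))).smul
      hcont.continuousAt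
  refine tendsto_nhds_unique (hc.tendsto.comp (h'.tendsto_pastLimit hd hφ)) ?_
  refine ((tendsto_add_atTop_iff_nat 1).2 (h.tendsto_pastLimit hd hφ)).congr fun n => ?_
  rw [past_succ', projAct_mul (isFaithfulMap_past hφ n _) Matrix.PosSemidef.one hd]
  rfl

end Limit

/-! ### Continuity in the deformation parameter -/

section Continuity

variable {Ω : Type*} [MeasurableSpace Ω] {θ : Ω ≃ᵐ Ω} {A : Type*} [Fintype A]

lemma continuous_deformed_apply (ψ : A → SuperOp d) (f : A → ℝ) {X : ℝ → Mat d}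
    (hX : Continuous X) : Continuous fun α => deformed ψ f α (X α) := by
  simp only [deformed_apply]
  refine continuous_finsetSum _ fun a _ => ?_
  have he : Continuous fun α : ℝ => Real.exp (-α * f a) := by fun_prop
  exact he.smul ((ψ a).continuous_of_finiteDimensional.comp hX)

lemma continuous_past_apply (ψ : Ω → A → SuperOp d) (f : Ω → A → ℝ) (n : ℕ) (ω : Ω) (X : Mat d) :
    Continuous fun α => past θ (fun ω => deformed (ψ ω) (f ω) α) n ω X := by
  unfold past
  generalize θ.symm^[n] ω = ω'
  induction n with
  | zero => exact continuous_const
  | succ n ih => exact continuous_deformed_apply _ _ ih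

lemma continuous_projAct_past {ψ : Ω → A → SuperOp d} (hψ : ∀ ω, IsIrreducibleInstrument (ψ ω))
    (f : Ω → A → ℝ) (n : ℕ) (ω : Ω) {X : Mat d} (hX : X.PosSemidef) (h0 : X ≠ 0) :
    Continuous fun α => projAct (past θ (fun ω => deformed (ψ ω) (f ω) α) n ω) X := by
  have h := continuous_past_apply (θ := θ) ψ f n ω X
  exact (h.matrix_trace.inv₀ fun α => (isFaithfulMap_past
    (fun ω => (hψ ω).isFaithfulMap_deformed (f ω) α) n ω).trace_ne_zero hX h0).smul h

/-- Near `α`, the values `Z β ω` are uniformly approximated by the past products applied to the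
identity, which are continuous in `β`. -/
lemma tendsto_of_isForgetfulAt {ψ : Ω → A → SuperOp d} (hψ : ∀ ω, IsIrreducibleInstrument (ψ ω))
    (f : Ω → A → ℝ) (hd : (1 : Mat d) ≠ 0) {ω : Ω}
    (h : ∀ R : ℝ, IsForgetfulAt θ
      (fun (α : {α : ℝ // |α| ≤ R}) ω => deformed (ψ ω) (f ω) α) ω)
    {Z : ℝ → Ω → Mat d}
    (hZ : ∀ n α, IsEquivariantAt θ (fun ω => deformed (ψ ω) (f ω) α) (Z α) (θ.symm^[n] ω))
    (α : ℝ) : Tendsto (fun β => Z β ω) (𝓝 α) (𝓝 (Z α ω)) := by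
  refine tendsto_pi_nhds.2 fun p => tendsto_pi_nhds.2 fun q => ?_
  change ContinuousAt (fun β => Z β ω p q) α
  refine continuousAt_of_locally_uniform_approx_of_continuousAt fun u hu => ?_
  obtain ⟨ε, hε, hεu⟩ := Metric.mem_uniformity_dist.1 hu
  -- The radius `|α| + 1` makes the parameter set a neighbourhood of `α`.
  obtain ⟨n, hn⟩ := h (|α| + 1) (ε / 2) (by linarith)
  refine ⟨{β | |β| ≤ |α| + 1}, ?_,
    fun β => projAct (past θ (fun ω => deformed (ψ ω) (f ω) β) n ω) 1 p q, ?_, fun β hβ => ?_⟩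
  · filter_upwards [continuous_abs.continuousAt.eventually (gt_mem_nhds (lt_add_one |α|))]
      with β hβ using hβ.le
  · exact ((continuous_projAct_past hψ f n ω Matrix.PosSemidef.one hd).matrix_elem
      p q).continuousAt
  · refine hεu ?_
    have hs : Z β (θ.symm^[n] ω) ∈ states d :=
      mem_states_of_mem_faithfulStates (hZ n β).1
    rw [IsEquivariantAt.eq_past (fun ω => (hψ ω).isFaithfulMap_deformed (f ω) β)
      (fun n => hZ n β) n, dist_eq_norm]
    exact (hn n le_rfl ⟨β, hβ⟩ _ _ hs.1 (ne_zero_of_mem_states hs) Matrix.PosSemidef.one hd p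
      q).trans_lt (by linarith)

end Continuity

/-! ### Almost sure statements along backward orbits -/

section Orbits

variable {Ω : Type*} [MeasurableSpace Ω] {P : Measure Ω} {θ : Ω ≃ᵐ Ω} {A : Type*} [Fintype A]

lemma ae_forall_past (hθ : Ergodic θ P) {p : Ω → Prop} (h : ∀ᵐ ω ∂P, p ω) :
    ∀ᵐ ω ∂P, ∀ n : ℕ, p (θ.symm^[n] ω) :=
  ae_all_iff.2 fun n => (hθ.symm.toMeasurePreserving.iterate n).quasiMeasurePreserving.ae h

/-- The index type is free: a constant `α` serves uniqueness and existence, a bounded interval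
serves continuity. -/
lemma isForgetfulAt_of_frequently {ψ : Ω → A → SuperOp d}
    (hψ : ∀ ω, IsIrreducibleInstrument (ψ ω)) {f : Ω → A → ℝ} {N k : ℕ} {ω : Ω}
    (hω : ∃ᶠ n in atTop, θ.symm^[n] ω ∈ mixingSet θ ψ f N k) {ι : Type*} {α : ι → ℝ} {R : ℝ}
    (hα : ∀ i, |α i| ≤ R) :
    IsForgetfulAt θ (fun i ω => deformed (ψ ω) (f ω) (α i)) ω := by
  obtain ⟨η, hη, hη1, hmix⟩ := exists_isMixing_deformed (θ := θ) hψ f N k R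
  exact fun ε hε => exists_past_dist_le
    (fun i ω => (hψ ω).isFaithfulMap_deformed (f ω) (α i)) hη hη1
    (fun i ω hω => hmix (α i) (hα i) ω hω) hω hε

lemma isEquivariantAt_pastLimit (hd : (1 : Mat d) ≠ 0) {ψ : Ω → A → SuperOp d}
    (hψ : ∀ ω, IsIrreducibleInstrument (ψ ω)) {f : Ω → A → ℝ} {N k : ℕ} {ω : Ω}
    (hω : ∃ᶠ n in atTop, θ.symm^[n] ω ∈ mixingSet θ ψ f N k) (α : ℝ) :
    IsEquivariantAt θ (fun ω => deformed (ψ ω) (f ω) α)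
      (pastLimit θ fun ω => deformed (ψ ω) (f ω) α) ω := by
  set φ : Ω → SuperOp d := fun ω => deformed (ψ ω) (f ω) α
  have hφ : ∀ ω, IsFaithfulMap (φ ω) := fun ω => (hψ ω).isFaithfulMap_deformed (f ω) α
  have hforget : ∀ n, IsForgetfulAt θ (fun _ : Unit => φ) (θ.symm^[n] ω) := fun n =>
    isForgetfulAt_of_frequently hψ (frequently_shift hω n) (α := fun _ => α) fun _ => le_rfl
  have heq : ∀ n, projAct (φ (θ.symm^[n] ω)) (pastLimit θ φ (θ.symm (θ.symm^[n] ω))) =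
      pastLimit θ φ (θ.symm^[n] ω) := fun n =>
    (hforget n).projAct_pastLimit hd hφ (by
      rw [← Function.iterate_succ_apply' θ.symm]
      exact hforget (n + 1))
  have hst : ∀ n, pastLimit θ φ (θ.symm^[n] ω) ∈ states d := fun n =>
    (hforget n).pastLimit_mem_states hd hφ
  refine ⟨⟨?_, (hst 0).2⟩, heq 0⟩
  -- Positive definiteness: the limit is a past product of a state, and one mixing block bounds it
  -- below by a multiple of the image of the identity, which is positive definite.
  obtain ⟨η, hη, hη1, hmix⟩ := exists_isMixing_deformed (θ := θ) hψ f N k |α|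
  obtain ⟨n, hn⟩ := exists_past_close (φ := fun _ : Unit => φ) (fun _ => hφ) hη hη1
    (fun _ ω hω => hmix α le_rfl ω hω) 0 ω hω
  have hZ := hst n
  obtain ⟨a, b, ha, -, hlow, -⟩ := hn n le_rfl () 1 _ Matrix.PosSemidef.one hd hZ.1
    (ne_zero_of_mem_states hZ)
  have hp := isFaithfulMap_past hφ (θ := θ) n ω
  rw [eq_projAct_past hφ hst heq n, projAct_eq hp.pos hZ.1]
  exact posDef_smul (inv_pos.2 (hp.tr_pos hZ.1 (ne_zero_of_mem_states hZ)))
    (posDef_of_lower_bound (hp.posDef 1 Matrix.PosDef.one) ha hlow)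

end Orbits

end QMP

/-! ### The main theorem -/

theorem mainTheorem4 {d : ℕ} (hd : 1 ≤ d)
    {Ω : Type*} [MeasurableSpace Ω] (P : Measure Ω) [IsProbabilityMeasure P]
    (θ : Ω ≃ᵐ Ω) (hθ : Ergodic θ P)
    {A : Type*} [Fintype A]
    (ψ : Ω → A → QMP.SuperOp d)
    (hψ_meas : ∀ (a : A) (X : QMP.Mat d), QMP.MeasurableMat fun ω => ψ ω a X)
    (hψ : ∀ ω, QMP.IsIrreducibleInstrument (ψ ω))
    (f : Ω → A → ℝ) (hf_meas : ∀ a, Measurable fun ω => f ω a)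
    (hA2 : ∃ N₀ : ℕ, 0 < P {ω | QMP.IsPositivityImproving
      (QMP.composition θ (fun ω' => QMP.channel (ψ ω')) N₀ ω)})
    (hA3 : ∀ α : ℝ, Integrable (fun ω => Real.exp (α * QMP.maxAbs (f ω))) P) :
    (∀ (α : ℝ) (W W' : Ω → QMP.Mat d),
      QMP.IsEquivariantState P θ (fun ω => QMP.deformed (ψ ω) (f ω) α) W →
      QMP.IsEquivariantState P θ (fun ω => QMP.deformed (ψ ω) (f ω) α) W' →
      ∀ᵐ ω ∂P, W ω = W' ω) ∧
    (∃ Z : ℝ → Ω → QMP.Mat d,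
      QMP.IsEquivariantFamily P θ (fun α ω => QMP.deformed (ψ ω) (f ω) α) Z) ∧
    (∀ Z : ℝ → Ω → QMP.Mat d,
      QMP.IsEquivariantFamily P θ (fun α ω => QMP.deformed (ψ ω) (f ω) α) Z →
      ∀ᵐ ω ∂P, ∀ α : ℝ,
        Tendsto (fun β => QMP.traceNorm (Z β ω - Z α ω)) (𝓝 α) (𝓝 0) ∧
        Tendsto (fun β => QMP.projDist (Z β ω) (Z α ω)) (𝓝 α) (𝓝 0)) := by
  have h1 : (1 : QMP.Mat d) ≠ 0 := by
    have : Nonempty (Fin d) := ⟨⟨0, hd⟩⟩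
    exact one_ne_zero
  obtain ⟨N, hN⟩ := hA2
  obtain ⟨k, hk⟩ := QMP.exists_ae_frequently_mixingSet hθ hψ_meas hψ hf_meas hN
  refine ⟨fun α W W' hW hW' => ?_,
    ⟨fun α => QMP.pastLimit θ fun ω => QMP.deformed (ψ ω) (f ω) α, fun α => ?_, ?_⟩,
    fun Z hZ => ?_⟩
  · filter_upwards [hk, QMP.ae_forall_past hθ hW.2, QMP.ae_forall_past hθ hW'.2] with ω hω h h'
    exact (QMP.isForgetfulAt_of_frequently hψ hω (α := fun _ => α)
      fun _ => le_rfl).eq_of_equivariant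
      (fun ω => (hψ ω).isFaithfulMap_deformed (f ω) α) h h'
  · exact QMP.measurableMat_pastLimit (QMP.measurableMat_deformed hψ_meas hf_meas α)
  -- The recurrence event does not involve `α`, so one null set serves all parameters.
  · filter_upwards [hk] with ω hω α
    exact QMP.isEquivariantAt_pastLimit h1 hψ hω α
  · filter_upwards [hk, QMP.ae_forall_past hθ hZ.2] with ω hω h α
    have hlim := QMP.tendsto_of_isForgetfulAt hψ f h1
      (fun R => QMP.isForgetfulAt_of_frequently hψ hω fun i : {α : ℝ // |α| ≤ R} => i.2) h α
    exact ⟨QMP.tendsto_traceNorm_sub hlim, QMP.tendsto_projDist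
      (fun β => QMP.mem_states_of_mem_faithfulStates (h 0 β).1) (h 0 α).1 hlim⟩
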